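/- For $n\in\mathbb N_0$, $k\in\mathbb R$ let $\mathbb O^n_k$ be the model space form: $\mathbb R^n$ if $k=0$; $\{x\in\mathbb R^{n+1}:\langle x,x\rangle=1/k\}$ with the Euclidean product if $k>0$; $\{x\in\mathbb R^{n+1}:\langle x,x\rangle=1/k,\ x_0>0\}$ with the Lorentzian product $\langle x,y\rangle=-x_0y_0+\sum_{a\ge1}x_ay_a$ if $k<0$. Let $\hat{\mathbb O}=\mathbb O^{n_1}_{k_1}\times\cdots\times\mathbb O^{n_\ell}_{k_\ell}$ with the product metric, and let $\pi_i$ be the projection $\pi_i(x_1,\dots,x_\ell)=(0,\dots,x_i,\dots,0)$, acting on tangent vectors of $\hat{\mathbb O}$. Let $M^m$ be a (nonempty) connected Riemannian manifold and $f:M^m\to\hat{\mathbb O}$ a smooth isometric immersion, with normal bundle $T^\perp M\subset f^*T\hat{\mathbb O}$, normal connection $\nabla^\perp$ and second fundamental form $\alpha$. Let $K_i=\pi_i|_{T^\perp M}:T^\perp M\to T\hat{\mathbb O}$, $T_i=K_i^{t}K_i:T^\perp M\to T^\perp M$, where $K_i^{t}$ is the adjoint of $K_i$, and $\mathcal V_i=\ker(\mathrm{Id}-T_i)$.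 Let $\mathcal N_1(p)=\operatorname{span}\{\alpha(X,Y):X,Y\in T_pM\}$ be the first normal space and $\mathcal N_1^\perp$ its orthogonal complement in $T^\perp M$. **Theorem 4.2.** For every $i\in\{1,\dots,\ell\}$ and every integer $\bar n\ge 0$ the following are equivalent: (I) The codimension of $f$ is reduced by $\bar n$ at the $i$-th coordinate, i.e. $\bar n\le n_i$ and there is a totally geodesic submanifold $\mathbb O^{n_i-\bar n}_{k_i}\subset\mathbb O^{n_i}_{k_i}$ (the image of a totally geodesic isometric embedding $\mathbb O^{n_i-\bar n}_{k_i}\hookrightarrow\mathbb O^{n_i}_{k_i}$) such that $f(M)\subset\mathbb O^{n_1}_{k_1}\times\cdots\times\mathbb O^{n_i-\bar n}_{k_i}\times\cdots\times\mathbb O^{n_\ell}_{k_\ell}$. (II) There is a smooth vector subbundle $L\subset T^\perp M$ of rank $\bar n$ with $L\subset\mathcal V_i\cap\mathcal N_1^\perp$ which is parallel in the normal connection, i.e. $\nabla^\perp_X\xi\in L$ for every smooth (local) section $\xi$ of $L$ and every tangent vector $X$. -/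

import Mathlib

open scoped Manifold ContDiff Bundle

noncomputable section

namespace SpaceFormProduct

/-! ### Space forms -/

/-- The number of extra coordinates of the ambient space of the model: `1` if `k ≠ 0`, else `0`. -/
def extraDim (k : ℝ) : ℕ := open Classical in if k = 0 then 0 else 1

/-- The ambient vector space `ℝ^(n + v(k))` of the space form of dimension `n` and curvature `k`
(the Euclidean norm is used only for its topology and smooth structure). -/
abbrev Factor (n : ℕ) (k : ℝ) : Type := EuclideanSpace ℝ (Fin (n + extraDim k))

/-- Sign of the coordinate `a`: negative exactly for the zeroth coordinate when `k < 0`. -/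
def coordSign {n : ℕ} {k : ℝ} (a : Fin (n + extraDim k)) : ℝ :=
  open Classical in if k < 0 ∧ (a : ℕ) = 0 then -1 else 1

/-- The inner product of the ambient space: Euclidean if `k ≥ 0`, Lorentzian
`-x₀y₀ + x₁y₁ + ⋯ + xₙyₙ` if `k < 0`. -/
def factorForm (n : ℕ) (k : ℝ) : LinearMap.BilinForm ℝ (Factor n k) :=
  LinearMap.mk₂ ℝ (fun x y => ∑ a, coordSign a * x a * y a)
    (fun x x' y => by
      rw [← Finset.sum_add_distrib]
      exact Finset.sum_congr rfl fun a _ => by rw [PiLp.add_apply]; ring)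
    (fun c x y => by
      rw [smul_eq_mul, Finset.mul_sum]
      exact Finset.sum_congr rfl fun a _ => by rw [PiLp.smul_apply, smul_eq_mul]; ring)
    (fun x y y' => by
      rw [← Finset.sum_add_distrib]
      exact Finset.sum_congr rfl fun a _ => by rw [PiLp.add_apply]; ring)
    (fun c x y => by
      rw [smul_eq_mul, Finset.mul_sum]
      exact Finset.sum_congr rfl fun a _ => by rw [PiLp.smul_apply, smul_eq_mul]; ring)

theorem factorForm_apply {n : ℕ} {k : ℝ} (x y : Factor n k) :
    factorForm n k x y = ∑ a, coordSign a * x a * y a := rfl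

/-- The model `𝕆ⁿ_k`: all of `ℝⁿ` if `k = 0`, the sphere `⟨x, x⟩ = 1/k` if `k > 0`, and the
upper sheet `x₀ > 0` of the hyperboloid `⟨x, x⟩ = 1/k` if `k < 0`. -/
def spaceForm (n : ℕ) (k : ℝ) : Set (Factor n k) :=
  {x | (k ≠ 0 → factorForm n k x x = 1 / k) ∧
    (k < 0 → ∀ a : Fin (n + extraDim k), (a : ℕ) = 0 → 0 < x a)}

/-- The tangent space `T_x 𝕆ⁿ_k`, as a subspace of the ambient space. -/
def spaceFormTangent {n : ℕ} {k : ℝ} (x : Factor n k) : Submodule ℝ (Factor n k) where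
  carrier := {X | k ≠ 0 → factorForm n k x X = 0}
  zero_mem' := fun _ => map_zero _
  add_mem' := fun {X Y} hX hY hk => by rw [map_add, hX hk, hY hk, add_zero]
  smul_mem' := fun c X hX hk => by rw [map_smul, hX hk, smul_zero]

/-- The induced metric of a space form is positive definite. -/
theorem factorForm_pos {n : ℕ} {k : ℝ} {x X : Factor n k} (hx : x ∈ spaceForm n k)
    (hX : X ∈ spaceFormTangent x) (h0 : X ≠ 0) : 0 < factorForm n k X X := by
  by_cases hk : k < 0
  · have he : extraDim k = 1 := by simp [extraDim, hk.ne]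
    obtain ⟨a₀, ha₀⟩ : ∃ a : Fin (n + extraDim k), (a : ℕ) = 0 := ⟨⟨0, by omega⟩, rfl⟩
    have key : ∀ y z : Factor n k,
        factorForm n k y z = -(y a₀ * z a₀) + ∑ a ∈ Finset.univ.erase a₀, y a * z a := by
      intro y z
      rw [factorForm_apply, ← Finset.add_sum_erase _ _ (Finset.mem_univ a₀)]
      congr 1
      · simp [coordSign, hk, ha₀]
      · refine Finset.sum_congr rfl fun a ha => ?_
        have hne : (a : ℕ) ≠ 0 := fun h =>
          (Finset.mem_erase.mp ha).1 (Fin.ext (h.trans ha₀.symm))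
        simp [coordSign, hne]
    have h1 : factorForm n k x x < 0 := by
      rw [hx.1 hk.ne]; exact one_div_neg.mpr hk
    have h2 : factorForm n k x X = 0 := hX hk.ne
    have h3 := hx.2 hk a₀ ha₀
    have cs := Finset.sum_mul_sq_le_sq_mul_sq (Finset.univ.erase a₀)
      (fun a => x a) (fun a => X a)
    rw [key] at h1 h2 ⊢
    simp only [← pow_two] at h1 ⊢
    set P := ∑ a ∈ Finset.univ.erase a₀, x a ^ 2 with hP
    set Q := ∑ a ∈ Finset.univ.erase a₀, X a ^ 2 with hQ
    have hQ0 : 0 ≤ Q := Finset.sum_nonneg fun a _ => sq_nonneg _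
    have hQpos : 0 < Q := by
      rcases hQ0.lt_or_eq with h | h
      · exact h
      · exfalso
        apply h0
        have hz : ∀ a ∈ Finset.univ.erase a₀, X a ^ 2 = 0 :=
          (Finset.sum_eq_zero_iff_of_nonneg fun a _ => sq_nonneg _).mp h.symm
        have hs : ∑ a ∈ Finset.univ.erase a₀, x a * X a = 0 :=
          Finset.sum_eq_zero fun a ha => by rw [pow_eq_zero_iff two_ne_zero |>.mp (hz a ha), mul_zero]
        rw [hs] at h2
        have hX0 : X a₀ = 0 := by
          have : x a₀ * X a₀ = 0 := by linarith
          exact (mul_eq_zero.mp this).resolve_left h3.ne'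
        ext a
        by_cases ha : a = a₀
        · rw [ha, hX0]; rfl
        · exact pow_eq_zero_iff two_ne_zero |>.mp
            (hz a (Finset.mem_erase.mpr ⟨ha, Finset.mem_univ a⟩))
    have h4 : ∑ a ∈ Finset.univ.erase a₀, x a * X a = x a₀ * X a₀ := by linarith
    rw [h4, mul_pow] at cs
    have h5 : P * Q < x a₀ ^ 2 * Q := by
      apply mul_lt_mul_of_pos_right _ hQpos
      linarith
    have h6 : x a₀ ^ 2 * X a₀ ^ 2 < x a₀ ^ 2 * Q := lt_of_le_of_lt cs h5
    have h7 := lt_of_mul_lt_mul_left h6 (sq_nonneg _)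
    linarith
  · have key : factorForm n k X X = ∑ a, X a ^ 2 := by
      rw [factorForm_apply]
      exact Finset.sum_congr rfl fun a _ => by simp [coordSign, hk, pow_two]
    rw [key]
    obtain ⟨a, ha⟩ : ∃ a, X a ≠ 0 := by
      by_contra! h
      exact h0 (by ext a; exact h a)
    exact Finset.sum_pos' (fun a _ => sq_nonneg _) ⟨a, Finset.mem_univ a, by positivity⟩

/-- A (complete) geodesic of `𝕆ⁿ_k`: a smooth curve in `𝕆ⁿ_k` whose acceleration in the ambient
space is everywhere normal to `𝕆ⁿ_k`, i.e. whose covariant acceleration vanishes. -/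
structure IsGeodesic (n : ℕ) (k : ℝ) (γ : ℝ → Factor n k) : Prop where
  contDiff : ContDiff ℝ ∞ γ
  mem : ∀ t, γ t ∈ spaceForm n k
  normal_acceleration : ∀ t, ∀ X ∈ spaceFormTangent (γ t),
    factorForm n k (deriv (deriv γ) t) X = 0

/-- `J` restricts to a totally geodesic isometric embedding `𝕆ᵐ_k ↪ 𝕆ⁿ_k`.  As `𝕆ᵐ_k` is a closed
submanifold of its ambient space, the smooth maps on it are the restrictions of smooth maps on
that space.  Totally geodesic: geodesics of `𝕆ᵐ_k` are carried to geodesics of `𝕆ⁿ_k`. -/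
structure IsTotallyGeodesicEmbedding (m n : ℕ) (k : ℝ) (J : Factor m k → Factor n k) : Prop where
  contDiff : ContDiff ℝ ∞ J
  mapsTo : Set.MapsTo J (spaceForm m k) (spaceForm n k)
  isEmbedding : Topology.IsEmbedding ((spaceForm m k).domRestrict J)
  isometric : ∀ x ∈ spaceForm m k, ∀ X ∈ spaceFormTangent x, ∀ Y ∈ spaceFormTangent x,
    factorForm n k (fderiv ℝ J x X) (fderiv ℝ J x Y) = factorForm m k X Y
  totallyGeodesic : ∀ γ : ℝ → Factor m k, IsGeodesic m k γ → IsGeodesic n k (J ∘ γ)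

/-- `S` is a totally geodesic submanifold `𝕆ᵐ_k ⊂ 𝕆ⁿ_k`. -/
def IsTotallyGeodesicSpaceForm (m n : ℕ) (k : ℝ) (S : Set (Factor n k)) : Prop :=
  ∃ J : Factor m k → Factor n k, IsTotallyGeodesicEmbedding m n k J ∧ J '' spaceForm m k = S

/-! ### Adjoints with respect to nondegenerate forms -/

/-- The adjoint `Kᵗ : W → V` of `K : V → W`, determined by `⟨Kᵗ Z, v⟩_V = ⟨Z, K v⟩_W`. -/
def formAdjoint {V W : Type*} [AddCommGroup V] [Module ℝ V] [FiniteDimensional ℝ V]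
    [AddCommGroup W] [Module ℝ W] (BV : LinearMap.BilinForm ℝ V) (hV : BV.Nondegenerate)
    (BW : LinearMap.BilinForm ℝ W) (K : V →ₗ[ℝ] W) : W →ₗ[ℝ] V :=
  (BV.toDual hV).symm.toLinearMap ∘ₗ K.dualMap ∘ₗ BW

theorem formAdjoint_spec {V W : Type*} [AddCommGroup V] [Module ℝ V] [FiniteDimensional ℝ V]
    [AddCommGroup W] [Module ℝ W] (BV : LinearMap.BilinForm ℝ V) (hV : BV.Nondegenerate)
    (BW : LinearMap.BilinForm ℝ W) (K : V →ₗ[ℝ] W) (Z : W) (v : V) :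
    BV (formAdjoint BV hV BW K Z) v = BW Z (K v) :=
  LinearMap.BilinForm.apply_toDual_symm_apply (hB := hV) (K.dualMap (BW Z)) v

/-! ### Products of space forms -/

section Product

variable {l : ℕ} (n : Fin l → ℕ) (k : Fin l → ℝ)

/-- The ambient space `ℝᴺ = ℝ^{N₁} × ⋯ × ℝ^{N_ℓ}`. -/
abbrev Ambient : Type := ∀ j : Fin l, Factor (n j) (k j)

/-- The inner product of `ℝᴺ`. -/
def ambientForm : LinearMap.BilinForm ℝ (Ambient n k) :=
  LinearMap.mk₂ ℝ (fun x y => ∑ j, factorForm (n j) (k j) (x j) (y j))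
    (fun x x' y => by simp [Finset.sum_add_distrib])
    (fun c x y => by simp [Finset.mul_sum])
    (fun x y y' => by simp [Finset.sum_add_distrib])
    (fun c x y => by simp [Finset.mul_sum])

theorem ambientForm_apply (x y : Ambient n k) :
    ambientForm n k x y = ∑ j, factorForm (n j) (k j) (x j) (y j) := rfl

/-- The product `𝕆̂ = 𝕆^{n₁}_{k₁} × ⋯ × 𝕆^{n_ℓ}_{k_ℓ}`, as a subset of `ℝᴺ`. -/
def productSpace : Set (Ambient n k) := {x | ∀ j, x j ∈ spaceForm (n j) (k j)}

variable {n k}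

/-- The tangent space `T_x 𝕆̂`. -/
def productTangent (x : Ambient n k) : Submodule ℝ (Ambient n k) :=
  Submodule.pi Set.univ fun j => spaceFormTangent (x j)

variable (n k) in
/-- The projection `π_i (x₁, …, x_ℓ) = (0, …, 0, x_i, 0, …, 0)`. -/
def proj (i : Fin l) : Ambient n k →ₗ[ℝ] Ambient n k :=
  LinearMap.single ℝ (fun j => Factor (n j) (k j)) i ∘ₗ LinearMap.proj i

theorem proj_mem_productTangent (i : Fin l) (x : Ambient n k) {X : Ambient n k}
    (hX : X ∈ productTangent x) : proj n k i X ∈ productTangent x := by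
  intro j _
  by_cases h : j = i
  · subst h
    simpa [proj] using hX j trivial
  · simp [proj, h]

theorem ambientForm_pos {x X : Ambient n k} (hx : x ∈ productSpace n k)
    (hX : X ∈ productTangent x) (h0 : X ≠ 0) : 0 < ambientForm n k X X := by
  obtain ⟨j, hj⟩ : ∃ j, X j ≠ 0 := by
    by_contra! h
    exact h0 (funext h)
  rw [ambientForm_apply]
  refine Finset.sum_pos' (fun j _ => ?_)
    ⟨j, Finset.mem_univ j, factorForm_pos (hx j) (hX j trivial) hj⟩
  by_cases h : X j = 0
  · rw [h, map_zero]
  · exact (factorForm_pos (hx j) (hX j trivial) h).le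

theorem restrict_nondegenerate {x : Ambient n k} (hx : x ∈ productSpace n k)
    (W : Submodule ℝ (Ambient n k)) (hW : W ≤ productTangent x) :
    ((ambientForm n k).restrict W).Nondegenerate := by
  have h : ∀ w : W, (ambientForm n k).restrict W w w = 0 → w = 0 := by
    intro w hw
    by_contra h0
    have hpos := ambientForm_pos hx (hW w.2) fun h => h0 (Subtype.ext h)
    exact hpos.ne' hw
  exact ⟨fun w hw => h w (hw w), fun w hw => h w (hw w)⟩

end Product

/-! ### Isometric immersions -/

/-- An isometric immersion `f : Mᵐ → 𝕆̂` of a Riemannian manifold into a product of space forms. -/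
structure IsometricImmersion {l : ℕ} (n : Fin l → ℕ) (k : Fin l → ℝ) (m : ℕ) (M : Type*)
    [TopologicalSpace M] [ChartedSpace (EuclideanSpace ℝ (Fin m)) M]
    [Bundle.RiemannianBundle (fun x : M => TangentSpace (𝓡 m) x)] where
  /-- The underlying map, with values in `ℝᴺ`. -/
  toFun : M → Ambient n k
  contMDiff : ContMDiff (𝓡 m) 𝓘(ℝ, Ambient n k) ∞ toFun
  mem : ∀ p, toFun p ∈ productSpace n k
  isometric : ∀ (p : M) (X Y : TangentSpace (𝓡 m) p),
    ambientForm n k (mfderiv (𝓡 m) 𝓘(ℝ, Ambient n k) toFun p X)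
      (mfderiv (𝓡 m) 𝓘(ℝ, Ambient n k) toFun p Y) = inner ℝ X Y

namespace IsometricImmersion

variable {l : ℕ} {n : Fin l → ℕ} {k : Fin l → ℝ} {m : ℕ} {M : Type*}
  [TopologicalSpace M] [ChartedSpace (EuclideanSpace ℝ (Fin m)) M]
  [Bundle.RiemannianBundle (fun x : M => TangentSpace (𝓡 m) x)]
  (f : IsometricImmersion n k m M)

/-- The tangent space of `𝕆̂` at `f p`. -/
abbrev targetTangent (p : M) : Submodule ℝ (Ambient n k) := productTangent (f.toFun p)

/-- The derivative of a map `ζ : M → ℝᴺ` at `p` in the direction `X` (the flat connection of `ℝᴺ`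
along `f`). -/
def flatDeriv (ζ : M → Ambient n k) (p : M) (X : TangentSpace (𝓡 m) p) : Ambient n k :=
  mfderiv (𝓡 m) 𝓘(ℝ, Ambient n k) ζ p X

/-- `f_* X`. -/
def push (p : M) (X : TangentSpace (𝓡 m) p) : Ambient n k := flatDeriv f.toFun p X

/-- The normal space `T^⊥_p M`, the orthogonal complement of `f_* T_p M` in `T_{f p} 𝕆̂`. -/
def normalSpace (p : M) : Submodule ℝ (Ambient n k) where
  carrier := {ξ | ξ ∈ f.targetTangent p ∧
    ∀ X : TangentSpace (𝓡 m) p, ambientForm n k (f.push p X) ξ = 0}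
  zero_mem' := ⟨Submodule.zero_mem _, fun _ => map_zero _⟩
  add_mem' := fun {ξ η} hξ hη => ⟨Submodule.add_mem _ hξ.1 hη.1, fun X => by
    rw [map_add, hξ.2 X, hη.2 X, add_zero]⟩
  smul_mem' := fun c ξ hξ => ⟨Submodule.smul_mem _ c hξ.1, fun X => by
    rw [map_smul, hξ.2 X, smul_zero]⟩

theorem normalSpace_le (p : M) : f.normalSpace p ≤ f.targetTangent p := fun _ h => h.1

/-- The metric of `T_{f p} 𝕆̂`. -/
def targetMetric (p : M) : LinearMap.BilinForm ℝ (f.targetTangent p) :=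
  (ambientForm n k).restrict (f.targetTangent p)

/-- The metric of the normal bundle. -/
def normalMetric (p : M) : LinearMap.BilinForm ℝ (f.normalSpace p) :=
  (ambientForm n k).restrict (f.normalSpace p)

theorem targetMetric_nondegenerate (p : M) : (f.targetMetric p).Nondegenerate :=
  restrict_nondegenerate (f.mem p) _ le_rfl

theorem normalMetric_nondegenerate (p : M) : (f.normalMetric p).Nondegenerate :=
  restrict_nondegenerate (f.mem p) _ (f.normalSpace_le p)

/-- The orthogonal projection `ℝᴺ → T_{f p} 𝕆̂`, the adjoint of the inclusion. -/
def toTarget (p : M) : Ambient n k →ₗ[ℝ] f.targetTangent p :=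
  formAdjoint (f.targetMetric p) (f.targetMetric_nondegenerate p) (ambientForm n k)
    (f.targetTangent p).subtype

/-- The orthogonal projection `T_{f p} 𝕆̂ → T^⊥_p M`, `Z ↦ Z^⊥`, the adjoint of the inclusion. -/
def toNormal (p : M) : f.targetTangent p →ₗ[ℝ] f.normalSpace p :=
  formAdjoint (f.normalMetric p) (f.normalMetric_nondegenerate p) (f.targetMetric p)
    (Submodule.inclusion (f.normalSpace_le p))

/-- The Levi-Civita connection of `𝕆̂` along `f`: `∇̄_X ζ` is the tangential part of the derivative
of `ζ` in `ℝᴺ`. -/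
def covDeriv (ζ : M → Ambient n k) (p : M) (X : TangentSpace (𝓡 m) p) : f.targetTangent p :=
  f.toTarget p (flatDeriv ζ p X)

/-- The normal connection `∇^⊥_X ξ = (∇̄_X ξ)^⊥`. -/
def normalConnection (ξ : ∀ q, f.normalSpace q) (p : M) (X : TangentSpace (𝓡 m) p) :
    f.normalSpace p :=
  f.toNormal p (f.covDeriv (fun q => (ξ q : Ambient n k)) p X)

/-- The second fundamental form `α(X, Y) = (∇̄_X f_* Y)^⊥` at `p`, for a tangent vector `X` at `p`
and a vector field `Y`. -/
def secondFundamentalForm (p : M) (X : TangentSpace (𝓡 m) p) (Y : ∀ q : M, TangentSpace (𝓡 m) q) :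
    f.normalSpace p :=
  f.toNormal p (f.covDeriv (fun q => f.push q (Y q)) p X)

/-- The first normal space `N₁(p)`, spanned by all the values `α(X, Y)` at `p`, where `X ∈ T_p M`
and `Y` is a vector field that is smooth near `p`. -/
def firstNormalSpace [IsManifold (𝓡 m) ∞ M] (p : M) : Submodule ℝ (f.normalSpace p) :=
  Submodule.span ℝ {η | ∃ (X : TangentSpace (𝓡 m) p) (Y : ∀ q : M, TangentSpace (𝓡 m) q)
    (U : Set M), IsOpen U ∧ p ∈ U ∧
    ContMDiffOn (𝓡 m) (𝓡 m).tangent ∞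
      (fun q => (⟨q, Y q⟩ : TangentBundle (𝓡 m) M)) U ∧
    η = f.secondFundamentalForm p X Y}

/-- `N₁(p)^⊥`, the orthogonal complement of the first normal space in `T^⊥_p M`. -/
def firstNormalSpaceOrth [IsManifold (𝓡 m) ∞ M] (p : M) : Submodule ℝ (f.normalSpace p) :=
  (f.normalMetric p).orthogonal (f.firstNormalSpace p)

/-- `K_i : T^⊥_p M → T_{f p} 𝕆̂`, the restriction of `π_i`. -/
def tensorK (i : Fin l) (p : M) : f.normalSpace p →ₗ[ℝ] f.targetTangent p :=
  (proj n k i).restrict fun _ hξ => proj_mem_productTangent i _ (f.normalSpace_le p hξ)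

/-- `T_i = K_iᵗ K_i : T^⊥_p M → T^⊥_p M`. -/
def tensorT (i : Fin l) (p : M) : f.normalSpace p →ₗ[ℝ] f.normalSpace p :=
  formAdjoint (f.normalMetric p) (f.normalMetric_nondegenerate p) (f.targetMetric p)
    (f.tensorK i p) ∘ₗ f.tensorK i p

/-- `V_i = ker (Id - T_i)`. -/
def kerIdSubT (i : Fin l) (p : M) : Submodule ℝ (f.normalSpace p) :=
  LinearMap.ker (LinearMap.id - f.tensorT i p)

/-- The normal field `ξ` is smooth on `U`. -/
def SmoothNormalFieldOn (ξ : ∀ q, f.normalSpace q) (U : Set M) : Prop :=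
  ContMDiffOn (𝓡 m) 𝓘(ℝ, Ambient n k) ∞ (fun q => (ξ q : Ambient n k)) U

/-- `L` is a smooth vector subbundle of rank `r` of `T^⊥ M`: near each point there is a smooth
local frame of `r` sections. -/
def IsNormalSubbundle (r : ℕ) (L : ∀ p, Submodule ℝ (f.normalSpace p)) : Prop :=
  ∀ p : M, ∃ U : Set M, IsOpen U ∧ p ∈ U ∧ ∃ ξ : Fin r → ∀ q, f.normalSpace q,
    (∀ a, f.SmoothNormalFieldOn (ξ a) U) ∧
    ∀ q ∈ U, LinearIndependent ℝ (fun a => ξ a q) ∧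
      Submodule.span ℝ (Set.range fun a => ξ a q) = L q

/-- `L` is parallel in the normal connection: `∇^⊥_X ξ` is in `L` for every (local) smooth section
`ξ` of `L` and every tangent vector `X`. -/
def IsParallelNormal (L : ∀ p, Submodule ℝ (f.normalSpace p)) : Prop :=
  ∀ (U : Set M) (ξ : ∀ q, f.normalSpace q), IsOpen U → f.SmoothNormalFieldOn ξ U →
    (∀ q ∈ U, ξ q ∈ L q) →
    ∀ p ∈ U, ∀ X : TangentSpace (𝓡 m) p, f.normalConnection ξ p X ∈ L p

/-- The codimension of `f` is reduced by `r` at the `i`-th coordinate: there is a totally geodesic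
`𝕆^{n_i - r}_{k_i} ⊂ 𝕆^{n_i}_{k_i}` such that
`f(M) ⊂ 𝕆^{n₁}_{k₁} × ⋯ × 𝕆^{n_i - r}_{k_i} × ⋯ × 𝕆^{n_ℓ}_{k_ℓ}`. -/
def CodimReducedBy (i : Fin l) (r : ℕ) : Prop :=
  ∃ (d : ℕ) (S : Set (Factor (n i) (k i))), d + r = n i ∧
    IsTotallyGeodesicSpaceForm d (n i) (k i) S ∧
    Set.range f.toFun ⊆ {x | x ∈ productSpace n k ∧ x i ∈ S}

end IsometricImmersion

end SpaceFormProduct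

end

/-! Both conditions are equivalent to a linear one, `HasConstantNormals`: a fixed `r`-dimensional
subspace `N` of the ambient space of the `i`-th factor, tangent to the space form at every point
`f(p)_i`, such that each `⟨f_i, ξ⟩`, `ξ ∈ N`, is constant. If `k_i ≠ 0`, tangency already means
`⟨f_i, ξ⟩ = 0` and `f_i` lies in a linear subspace; if `k_i = 0`, tangency is vacuous and `f_i` lies
in an affine subspace.

From `N` to a reduction (`exists_isTotallyGeodesicEmbedding`): an orthonormal basis of `N^⊥` in one
tangent space, together with the normalised base point if `k_i ≠ 0`, spans an isometric copy of a
smaller model's ambient space. Its intersection with the space form, translated to the base point if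
`k_i = 0`, is totally geodesic and contains the image of `f_i`.

From a reduction to `N` (`exists_orthogonal`): let `ξ` be orthogonal to the image of `dJ` at one
point and, if `k_i ≠ 0`, to that point's image. A geodesic `c` of constant squared speed `s`
satisfies `c'' = -k s c`, so `⟨c, ξ⟩` minus its initial value solves a linear equation with zero
initial data. As geodesics from the base point reach every point, `⟨J, ξ⟩` is constant. Only the
zero-dimensional sphere escapes this; there connectedness of `M` makes `f_i` constant.

From `N` to `L`: constant fields with values in `N` are normal and have zero flat derivative, so
they span a parallel subbundle orthogonal to `N₁`.

From `L` to `N`: for a section `ξ` of `L`, lying in `V_i` kills the other components, and lying in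
`N₁^⊥` kills the tangential part of its derivative. Hence the flat derivative equals `∇^⊥ξ` and
stays in `L` (`flatDeriv_mem_of_parallel`). A subbundle preserved by the flat derivative is locally
a fixed subspace (`eventually_map_subtype_eq`), and connectedness makes it global. -/

noncomputable section

namespace SpaceFormProduct

/-! ### Linear algebra of a single space form -/

section Factor

variable {n : ℕ} {k : ℝ}

theorem coordSign_mul_self (a : Fin (n + extraDim k)) :
    coordSign a * coordSign a = 1 := by
  unfold coordSign
  split_ifs <;> norm_num

theorem factorForm_comm (x y : Factor n k) : factorForm n k x y = factorForm n k y x := by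
  simp only [factorForm_apply]
  exact Finset.sum_congr rfl fun a _ => by ring

theorem factorForm_single (x : Factor n k) (a : Fin (n + extraDim k)) :
    factorForm n k x (EuclideanSpace.single a 1) = coordSign a * x a := by
  rw [factorForm_apply, Finset.sum_eq_single a]
  · simp
  · intro b _ hb
    simp [hb]
  · simp

theorem eq_zero_of_factorForm_eq_zero {x : Factor n k} (h : ∀ y, factorForm n k x y = 0) :
    x = 0 := by
  ext a
  have h1 := h (EuclideanSpace.single a 1)
  rw [factorForm_single] at h1
  have h2 : coordSign a * (coordSign a * x a) = 0 := by rw [h1, mul_zero]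
  rwa [← mul_assoc, coordSign_mul_self, one_mul] at h2

theorem factorForm_nondegenerate : (factorForm n k).Nondegenerate :=
  ⟨fun _ h => eq_zero_of_factorForm_eq_zero h,
    fun _ h => eq_zero_of_factorForm_eq_zero fun y => (factorForm_comm _ _).trans (h y)⟩

theorem extraDim_eq_zero (hk : k = 0) : extraDim k = 0 := by simp [extraDim, hk]

theorem extraDim_eq_one (hk : k ≠ 0) : extraDim k = 1 := by simp [extraDim, hk]

theorem factorForm_eq_neg_add (hk : k < 0) {a₀ : Fin (n + extraDim k)} (ha₀ : (a₀ : ℕ) = 0)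
    (y z : Factor n k) :
    factorForm n k y z = -(y a₀ * z a₀) + ∑ a ∈ Finset.univ.erase a₀, y a * z a := by
  rw [factorForm_apply, ← Finset.add_sum_erase _ _ (Finset.mem_univ a₀)]
  congr 1
  · simp [coordSign, hk, ha₀]
  · refine Finset.sum_congr rfl fun a ha => ?_
    have hne : (a : ℕ) ≠ 0 := fun h =>
      (Finset.mem_erase.mp ha).1 (Fin.ext (h.trans ha₀.symm))
    simp [coordSign, hne]

/-- Two timelike vectors have the same time orientation if and only if their product is
negative. -/
theorem factorForm_neg_iff_of_timelike (hk : k < 0) {y z : Factor n k}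
    {a₀ : Fin (n + extraDim k)} (ha₀ : (a₀ : ℕ) = 0) (hy : factorForm n k y y < 0)
    (hz : factorForm n k z z < 0) (hz0 : 0 < z a₀) : factorForm n k y z < 0 ↔ 0 < y a₀ := by
  have cs := Finset.sum_mul_sq_le_sq_mul_sq (Finset.univ.erase a₀)
    (fun a => y a) (fun a => z a)
  rw [factorForm_eq_neg_add hk ha₀] at hy hz ⊢
  simp only [← pow_two] at hy hz
  set P := ∑ a ∈ Finset.univ.erase a₀, y a ^ 2
  set Q := ∑ a ∈ Finset.univ.erase a₀, z a ^ 2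
  set S := ∑ a ∈ Finset.univ.erase a₀, y a * z a
  have hP0 : 0 ≤ P := Finset.sum_nonneg fun a _ => sq_nonneg _
  have hQ0 : 0 ≤ Q := Finset.sum_nonneg fun a _ => sq_nonneg _
  -- Timelikeness makes Cauchy-Schwarz strict: the spatial part is smaller than `|y₀ z₀|`, so the
  -- time part alone decides the sign.
  have hS : S ^ 2 < (y a₀ * z a₀) ^ 2 := by
    refine cs.trans_lt ?_
    rw [mul_pow]
    exact mul_lt_mul'' (by linarith) (by linarith) hP0 hQ0
  have habs := sq_lt_sq.mp hS
  constructor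
  · intro h
    by_contra! hle
    have : y a₀ * z a₀ ≤ 0 := mul_nonpos_of_nonpos_of_nonneg hle hz0.le
    rw [abs_of_nonpos this] at habs
    have := neg_abs_le S
    linarith
  · intro h
    have : 0 < y a₀ * z a₀ := mul_pos h hz0
    rw [abs_of_pos this] at habs
    have := le_abs_self S
    linarith

theorem mem_spaceFormTangent {x X : Factor n k} :
    X ∈ spaceFormTangent x ↔ (k ≠ 0 → factorForm n k x X = 0) := Iff.rfl

/-- The sheet is expressed through the form and a reference point instead of the zeroth coordinate,
so that membership transfers along linear isometries, which need not respect coordinates. -/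
theorem mem_spaceForm_iff_of_neg (hk : k < 0) {x₀ : Factor n k} (hx₀ : x₀ ∈ spaceForm n k)
    {x : Factor n k} :
    x ∈ spaceForm n k ↔ factorForm n k x x = 1 / k ∧ factorForm n k x x₀ < 0 := by
  obtain ⟨a₀, ha₀⟩ : ∃ a : Fin (n + extraDim k), (a : ℕ) = 0 :=
    ⟨⟨0, by rw [extraDim_eq_one hk.ne]; omega⟩, rfl⟩
  have hneg : 1 / k < 0 := one_div_neg.mpr hk
  constructor
  · intro hx
    refine ⟨hx.1 hk.ne, (factorForm_neg_iff_of_timelike hk ha₀ ?_ ?_ (hx₀.2 hk a₀ ha₀)).mpr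
      (hx.2 hk a₀ ha₀)⟩
    · rwa [hx.1 hk.ne]
    · rwa [hx₀.1 hk.ne]
  · intro h
    refine ⟨fun _ => h.1, fun _ a ha => ?_⟩
    refine (factorForm_neg_iff_of_timelike hk ha ?_ ?_ (hx₀.2 hk a ha)).mp h.2
    · rwa [h.1]
    · rwa [hx₀.1 hk.ne]

theorem mem_spaceForm_iff_of_pos (hk : 0 < k) {x : Factor n k} :
    x ∈ spaceForm n k ↔ factorForm n k x x = 1 / k :=
  ⟨fun h => h.1 hk.ne', fun h => ⟨fun _ => h, fun h' => absurd h' hk.not_gt⟩⟩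

theorem spaceForm_ne_zero (hk : k ≠ 0) {x : Factor n k} (hx : x ∈ spaceForm n k) : x ≠ 0 := by
  rintro rfl
  have := hx.1 hk
  rw [map_zero] at this
  exact one_div_ne_zero hk this.symm

theorem finrank_spaceFormTangent {x : Factor n k} (hx : x ∈ spaceForm n k) :
    Module.finrank ℝ (spaceFormTangent x) = n := by
  by_cases hk : k = 0
  · have : spaceFormTangent x = ⊤ := eq_top_iff.mpr fun X _ h => absurd hk h
    rw [this, finrank_top]
    simp [extraDim_eq_zero hk]
  · have : spaceFormTangent x = LinearMap.ker (factorForm n k x) := by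
      ext X
      simp [mem_spaceFormTangent, hk]
    rw [this]
    have hne : factorForm n k x ≠ 0 := fun h => spaceForm_ne_zero hk hx
      (eq_zero_of_factorForm_eq_zero fun y => by rw [h]; rfl)
    have h1 := Module.Dual.finrank_ker_add_one_of_ne_zero hne
    have h2 : Module.finrank ℝ (Factor n k) = n + 1 := by simp [extraDim_eq_one hk]
    omega

/-- A vector normal to the space form at `x` is a multiple of `x`, and zero if `k = 0`. -/
theorem eq_smul_of_normal {x v : Factor n k} (hx : x ∈ spaceForm n k)
    (hv : ∀ X ∈ spaceFormTangent x, factorForm n k v X = 0) :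
    v = (k * factorForm n k v x) • x := by
  by_contra hne
  -- The difference is both tangent and orthogonal to tangent vectors, hence orthogonal to itself,
  -- contradicting positivity unless it vanishes.
  have hw : v - (k * factorForm n k v x) • x ∈ spaceFormTangent x := by
    intro hk
    rw [map_sub, map_smul, hx.1 hk, factorForm_comm x v, smul_eq_mul]
    field_simp
    ring
  have hpos := factorForm_pos hx hw (sub_ne_zero.mpr hne)
  have h0 : factorForm n k (v - (k * factorForm n k v x) • x)
      (v - (k * factorForm n k v x) • x) = 0 := by
    rw [LinearMap.map_sub₂, hv _ hw, LinearMap.map_smul₂]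
    by_cases hk : k = 0
    · simp [hk]
    · rw [hw hk]; simp
  exact hpos.ne' h0

end Factor

/-! ### Subspaces of prescribed dimension and orthonormal bases -/

theorem exists_submodule_le_finrank_eq {V : Type*} [AddCommGroup V] [Module ℝ V]
    [FiniteDimensional ℝ V] (W : Submodule ℝ V) {r : ℕ} (hr : r ≤ Module.finrank ℝ W) :
    ∃ N ≤ W, Module.finrank ℝ N = r := by
  let b := Module.finBasis ℝ W
  have hli : LinearIndependent ℝ fun a : Fin r => ((b (Fin.castLE hr a) : W) : V) :=
    (b.linearIndependent.comp _ (Fin.castLE_injective hr)).map' W.subtype (Submodule.ker_subtype W)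
  refine ⟨Submodule.span ℝ (Set.range fun a : Fin r => ((b (Fin.castLE hr a) : W) : V)), ?_, ?_⟩
  · rw [Submodule.span_le]
    rintro _ ⟨a, rfl⟩
    exact (b _).2
  · rw [finrank_span_eq_card hli, Fintype.card_fin]

/-- A positive definite symmetric form admits an orthonormal basis. -/
theorem exists_orthonormal_basis {V : Type*} [AddCommGroup V] [Module ℝ V]
    [FiniteDimensional ℝ V] (B : LinearMap.BilinForm ℝ V) (hB : LinearMap.IsSymm B)
    (hpos : ∀ v, v ≠ 0 → 0 < B v v) {d : ℕ} (hd : Module.finrank ℝ V = d) :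
    ∃ b : Module.Basis (Fin d) ℝ V, ∀ a c, B (b a) (b c) = if a = c then 1 else 0 := by
  subst hd
  obtain ⟨v, hv⟩ := LinearMap.BilinForm.exists_orthogonal_basis (K := ℝ) hB
  have hvp : ∀ a, 0 < B (v a) (v a) := fun a => hpos _ (v.ne_zero a)
  refine ⟨v.isUnitSMul (w := fun a => (√(B (v a) (v a)))⁻¹) fun a =>
    (inv_ne_zero (Real.sqrt_pos.mpr (hvp a)).ne').isUnit, fun a c => ?_⟩
  rw [Module.Basis.isUnitSMul_apply, Module.Basis.isUnitSMul_apply, map_smul,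
    LinearMap.map_smul₂, smul_eq_mul, smul_eq_mul]
  split_ifs with h
  · subst h
    rw [← mul_assoc, ← mul_inv, Real.mul_self_sqrt (hvp a).le, inv_mul_cancel₀ (hvp a).ne']
  · rw [show B (v a) (v c) = 0 from hv h, mul_zero, mul_zero]

/-! ### Totally geodesic embeddings from linear isometries -/

section Embedding

variable {n : ℕ} {k : ℝ}

/-- An orthonormal basis of the orthogonal complement of `N` in the tangent space at `x₀`. -/
theorem exists_orthonormal_frame {x₀ : Factor n k} (hx₀ : x₀ ∈ spaceForm n k)
    {N : Submodule ℝ (Factor n k)} (hN : N ≤ spaceFormTangent x₀) {d : ℕ}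
    (hd : d + Module.finrank ℝ N = n) :
    ∃ e : Fin d → Factor n k, (∀ a c, factorForm n k (e a) (e c) = if a = c then 1 else 0) ∧
      (∀ a, e a ∈ spaceFormTangent x₀) ∧
      ∀ y ∈ spaceFormTangent x₀, (∀ ξ ∈ N, factorForm n k y ξ = 0) →
        y ∈ Submodule.span ℝ (Set.range e) := by
  set T := spaceFormTangent x₀ with hT
  set B : LinearMap.BilinForm ℝ T := (factorForm n k).restrict T with hB
  have hBapp : ∀ v w : T, B v w = factorForm n k v w := fun v w => rfl
  have hBpos : ∀ v : T, v ≠ 0 → 0 < B v v := fun v hv =>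
    factorForm_pos hx₀ v.2 fun h => hv (Subtype.ext h)
  have hBnd : B.Nondegenerate :=
    ⟨fun v hv => by_contra fun h => (hBpos v h).ne' (hv v),
      fun v hv => by_contra fun h => (hBpos v h).ne' (hv v)⟩
  set N' : Submodule ℝ T := N.comap T.subtype with hN'
  have hN'rank : Module.finrank ℝ N' = Module.finrank ℝ N :=
    (Submodule.comapSubtypeEquivOfLe hN).finrank_eq
  have hrank : Module.finrank ℝ (B.orthogonal N') = d := by
    rw [LinearMap.BilinForm.finrank_orthogonal hBnd, hN'rank, finrank_spaceFormTangent hx₀]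
    omega
  obtain ⟨b, hb⟩ := exists_orthonormal_basis (B.restrict (B.orthogonal N'))
    ⟨fun x y => factorForm_comm _ _⟩ (fun v hv => hBpos v fun h => hv (Subtype.ext h)) hrank
  refine ⟨fun a => ((b a : T) : Factor n k), hb, fun a => (b a : T).2, fun y hy hyN => ?_⟩
  have hmem : (⟨y, hy⟩ : T) ∈ B.orthogonal N' := by
    rw [LinearMap.BilinForm.mem_orthogonal_iff]
    intro ξ hξ
    exact (factorForm_comm _ _).trans (hyN ξ hξ)
  have h := b.mem_span ⟨⟨y, hy⟩, hmem⟩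
  have h2 := Submodule.mem_map_of_mem (f := T.subtype ∘ₗ (B.orthogonal N').subtype) h
  rw [Submodule.map_span, ← Set.range_comp] at h2
  exact h2

/-- The base point together with an orthonormal frame is an isometric copy of the standard
coordinate frame of a smaller model. -/
theorem exists_linear_isometry {x₀ : Factor n k} (hx₀ : x₀ ∈ spaceForm n k)
    {N : Submodule ℝ (Factor n k)} (hN : N ≤ spaceFormTangent x₀) {d : ℕ}
    (hd : d + Module.finrank ℝ N = n) :
    ∃ A : Factor d k →ₗ[ℝ] Factor n k,
      (∀ x y, factorForm n k (A x) (A y) = factorForm d k x y) ∧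
      (∃ z₀ ∈ spaceForm d k, k ≠ 0 → A z₀ = x₀) ∧
      ∀ y ∈ spaceFormTangent x₀, (∀ ξ ∈ N, factorForm n k y ξ = 0) → y ∈ LinearMap.range A := by
  obtain ⟨e, he, heT, hespan⟩ := exists_orthonormal_frame hx₀ hN hd
  classical
  set e' : ℕ → Factor n k := fun j => if h : j < d then e ⟨j, h⟩ else 0 with he'
  -- If `k ≠ 0`, slot `0` carries `√|k| x₀`, whose square `|k|/k = ±1` agrees with `coordSign`; the
  -- other slots carry `e`, shifted by `extraDim k`.
  set E : Fin (d + extraDim k) → Factor n k := fun a =>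
    if k ≠ 0 ∧ (a : ℕ) = 0 then √|k| • x₀ else e' (a - extraDim k) with hE
  have hE0 : ∀ a : Fin (d + extraDim k), k ≠ 0 → (a : ℕ) = 0 → E a = √|k| • x₀ :=
    fun a h1 h2 => if_pos ⟨h1, h2⟩
  have hE1 : ∀ a : Fin (d + extraDim k), ¬ (k ≠ 0 ∧ (a : ℕ) = 0) →
      ∃ j : Fin d, (a : ℕ) = j + extraDim k ∧ E a = e j := by
    intro a ha
    have ha2 := a.2
    have hlt : (a : ℕ) - extraDim k < d ∧ extraDim k ≤ a := by
      by_cases hk : k = 0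
      · have := extraDim_eq_zero hk
        omega
      · have := extraDim_eq_one hk
        have : (a : ℕ) ≠ 0 := fun h => ha ⟨hk, h⟩
        omega
    refine ⟨⟨a - extraDim k, hlt.1⟩, ?_, ?_⟩
    · simp only
      omega
    · simp only [hE, if_neg ha, he', dif_pos hlt.1]
  have hEe : ∀ j : Fin d, ∃ a, E a = e j := by
    intro j
    have hnot : ¬ (k ≠ 0 ∧ (j : ℕ) + extraDim k = 0) := by
      rintro ⟨h1, h2⟩
      rw [extraDim_eq_one h1] at h2
      omega
    obtain ⟨j', hj', h⟩ := hE1 ⟨j + extraDim k, by omega⟩ hnot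
    simp only [Nat.add_right_cancel_iff] at hj'
    exact ⟨_, by rw [h, Fin.ext hj'.symm]⟩
  have hEE : ∀ a b, factorForm n k (E a) (E b) = if a = b then coordSign a else 0 := by
    intro a b
    by_cases ha : k ≠ 0 ∧ (a : ℕ) = 0
    · by_cases hb : k ≠ 0 ∧ (b : ℕ) = 0
      · rw [if_pos (Fin.ext (ha.2.trans hb.2.symm)), hE0 a ha.1 ha.2, hE0 b hb.1 hb.2, map_smul,
          LinearMap.map_smul₂, hx₀.1 ha.1, smul_eq_mul, smul_eq_mul, ← mul_assoc,
          Real.mul_self_sqrt (abs_nonneg k)]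
        rcases lt_or_gt_of_ne ha.1 with h | h
        · rw [abs_of_neg h]
          simp only [coordSign, h, ha.2, and_self, if_true]
          field_simp [ha.1]
        · rw [abs_of_pos h]
          simp only [coordSign, h.not_gt, false_and, if_false]
          field_simp [ha.1]
      · obtain ⟨j, hj, hEb⟩ := hE1 b hb
        rw [hE0 a ha.1 ha.2, hEb, LinearMap.map_smul₂, heT j ha.1, smul_zero, if_neg]
        rintro rfl
        exact hb ha
    · obtain ⟨i, hi, hEa⟩ := hE1 a ha
      by_cases hb : k ≠ 0 ∧ (b : ℕ) = 0
      · rw [hE0 b hb.1 hb.2, hEa, map_smul, factorForm_comm, heT i hb.1, smul_zero, if_neg]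
        rintro rfl
        exact ha hb
      · obtain ⟨j, hj, hEb⟩ := hE1 b hb
        rw [hEa, hEb, he]
        by_cases hab : a = b
        · subst hab
          have hij : i = j := Fin.ext (by omega)
          have hs : coordSign (k := k) a = 1 :=
            if_neg fun h => ha ⟨h.1.ne, h.2⟩
          rw [if_pos hij, if_pos rfl, hs]
        · rw [if_neg hab, if_neg]
          rintro rfl
          exact hab (Fin.ext (by omega))
  let A : Factor d k →ₗ[ℝ] Factor n k :=
    Fintype.linearCombination ℝ E ∘ₗ (WithLp.linearEquiv 2 ℝ (Fin (d + extraDim k) → ℝ)).toLinearMap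
  have hA : ∀ x, A x = ∑ a, x a • E a := fun x => rfl
  have hAs : ∀ a, A (EuclideanSpace.single a 1) = E a := by
    intro a
    rw [hA, Finset.sum_eq_single a]
    · simp
    · intro b _ hb
      simp [hb]
    · simp
  refine ⟨A, fun x y => ?_, ?_, fun y hy hyN => ?_⟩
  · rw [hA, hA, map_sum, factorForm_apply]
    refine Finset.sum_congr rfl fun b _ => ?_
    rw [map_smul, map_sum, LinearMap.sum_apply, Finset.sum_eq_single b]
    · rw [LinearMap.map_smul₂, hEE, if_pos rfl, smul_eq_mul, smul_eq_mul]
      ring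
    · intro a _ hab
      rw [LinearMap.map_smul₂, hEE, if_neg hab, smul_zero]
    · simp
  · by_cases hk : k = 0
    · exact ⟨0, ⟨fun h => absurd hk h, fun h => absurd hk h.ne⟩, fun h => absurd hk h⟩
    · have hs : √|k| ≠ 0 := (Real.sqrt_pos.mpr (abs_pos.mpr hk)).ne'
      set a₀ : Fin (d + extraDim k) := ⟨0, by rw [extraDim_eq_one hk]; omega⟩
      refine ⟨(√|k|)⁻¹ • EuclideanSpace.single a₀ 1, ⟨fun _ => ?_, fun h a ha => ?_⟩, fun _ => ?_⟩
      · rw [map_smul, LinearMap.map_smul₂, factorForm_single, smul_eq_mul, smul_eq_mul,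
          ← mul_assoc, ← mul_inv, Real.mul_self_sqrt (abs_nonneg k)]
        simp only [PiLp.single_apply, if_true, mul_one]
        rcases lt_or_gt_of_ne hk with h | h
        · rw [abs_of_neg h]
          simp only [coordSign, h, a₀, and_self, if_true]
          field_simp [hk]
        · rw [abs_of_pos h]
          simp only [coordSign, h.not_gt, false_and, if_false]
          field_simp [hk]
      · have : a = a₀ := Fin.ext ha
        subst this
        simpa using hk
      · rw [map_smul, hAs, hE0 _ hk rfl, smul_smul, inv_mul_cancel₀ hs, one_smul]
  · have hle : Submodule.span ℝ (Set.range e) ≤ LinearMap.range A := by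
      rw [Submodule.span_le]
      rintro _ ⟨j, rfl⟩
      obtain ⟨a, ha⟩ := hEe j
      exact ⟨_, (hAs a).trans ha⟩
    exact hle (hespan y hy hyN)

/-- An affine isometry of the ambient spaces which maps `𝕆ᵈ_k` into `𝕆ⁿ_k`, and which is linear if
`k ≠ 0`, is a totally geodesic embedding. -/
theorem isTotallyGeodesicEmbedding_of_linear {d : ℕ} (A : Factor d k →ₗ[ℝ] Factor n k)
    (hA : ∀ x y, factorForm n k (A x) (A y) = factorForm d k x y) (c : Factor n k)
    (hc : k ≠ 0 → c = 0) (hmem : ∀ x ∈ spaceForm d k, A x + c ∈ spaceForm n k) :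
    IsTotallyGeodesicEmbedding d n k fun x => A x + c := by
  have hinj : Function.Injective A := by
    rw [← LinearMap.ker_eq_bot, LinearMap.ker_eq_bot']
    intro x hx
    exact eq_zero_of_factorForm_eq_zero fun y => by rw [← hA, hx, LinearMap.map_zero₂]
  set A' := LinearMap.toContinuousLinearMap A with hA'
  have hJ : (fun x => A x + c) = fun x => A' x + c := rfl
  have hfd : ∀ x, fderiv ℝ (fun x => A x + c) x = A' := by
    intro x
    rw [hJ]
    exact (A'.hasFDerivAt.add_const c).fderiv
  refine ⟨?_, hmem, ?_, ?_, ?_⟩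
  · rw [hJ]
    exact A'.contDiff.add contDiff_const
  · have h1 : Topology.IsEmbedding A := (LinearMap.isClosedEmbedding_of_injective
      (LinearMap.ker_eq_bot.mpr hinj)).isEmbedding
    exact ((Homeomorph.addRight c).isEmbedding.comp h1).comp Topology.IsEmbedding.subtypeVal
  · intro x _ X _ Y _
    rw [hfd]
    exact hA X Y
  · intro γ hγ
    have hd1 : deriv ((fun x => A x + c) ∘ γ) = fun t => A' (deriv γ t) := by
      funext t
      exact (A'.hasFDerivAt.comp_hasDerivAt t
        ((hγ.contDiff.differentiable (by simp)) t).hasDerivAt |>.add_const c).deriv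
    have hγ' : ContDiff ℝ ∞ (deriv γ) := ((contDiff_infty_iff_deriv (f := γ)).mp hγ.contDiff).2
    have hd2 : ∀ t, deriv (deriv ((fun x => A x + c) ∘ γ)) t = A (deriv (deriv γ) t) := by
      intro t
      rw [hd1]
      exact (A'.hasFDerivAt.comp_hasDerivAt t
        ((hγ'.differentiable (by simp)) t).hasDerivAt).deriv
    refine ⟨?_, fun t => hmem _ (hγ.mem t), fun t X hX => ?_⟩
    · rw [hJ]
      exact (A'.contDiff.add contDiff_const).comp hγ.contDiff
    -- The acceleration of `γ` is a multiple of `γ t`, so its image is a multiple of `A (γ t)`. This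
    -- is the position vector if `k ≠ 0`; if `k = 0` the factor vanishes, and the translation does
    -- no harm.
    · rw [hd2, eq_smul_of_normal (hγ.mem t) (hγ.normal_acceleration t), map_smul,
        LinearMap.map_smul₂]
      by_cases hk : k = 0
      · simp [hk]
      · have := hX hk
        simp only [Function.comp_apply, hc hk, add_zero] at this
        rw [this, smul_zero]

/-- The linear isometry preserves and reflects membership in the model, so it suffices to solve `A x
+ c = y` in the ambient spaces; there the component of `y` orthogonal to `N` is hit. -/
theorem exists_isTotallyGeodesicEmbedding {x₀ : Factor n k} (hx₀ : x₀ ∈ spaceForm n k)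
    {N : Submodule ℝ (Factor n k)} (hN : N ≤ spaceFormTangent x₀) {d : ℕ}
    (hd : d + Module.finrank ℝ N = n) :
    ∃ J, IsTotallyGeodesicEmbedding d n k J ∧
      ∀ y ∈ spaceForm n k, (∀ ξ ∈ N, factorForm n k y ξ = factorForm n k x₀ ξ) →
        y ∈ J '' spaceForm d k := by
  obtain ⟨A, hA, ⟨z₀, hz₀, hAz₀⟩, hrange⟩ := exists_linear_isometry hx₀ hN hd
  classical
  set c : Factor n k := if k = 0 then x₀ else 0 with hc
  have hck : k ≠ 0 → c = 0 := fun h => if_neg h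
  have hiff : ∀ x, A x + c ∈ spaceForm n k ↔ x ∈ spaceForm d k := by
    intro x
    rcases lt_trichotomy k 0 with hk | hk | hk
    · rw [hck hk.ne, add_zero, mem_spaceForm_iff_of_neg hk hx₀, mem_spaceForm_iff_of_neg hk hz₀,
        hA, ← hAz₀ hk.ne, hA]
    · exact ⟨fun _ => ⟨fun h => absurd hk h, fun h => absurd hk h.ne⟩,
        fun _ => ⟨fun h => absurd hk h, fun h => absurd hk h.ne⟩⟩
    · rw [hck hk.ne', add_zero, mem_spaceForm_iff_of_pos hk, mem_spaceForm_iff_of_pos hk, hA]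
  refine ⟨fun x => A x + c,
    isTotallyGeodesicEmbedding_of_linear A hA c hck fun x hx => (hiff x).mpr hx,
    fun y hy hyN => ?_⟩
  suffices h : ∃ x, A x + c = y by
    obtain ⟨x, rfl⟩ := h
    exact ⟨x, (hiff x).mp hy, rfl⟩
  by_cases hk : k = 0
  · obtain ⟨x, hx⟩ := hrange (y - x₀) (fun h => absurd hk h) fun ξ hξ => by
      rw [LinearMap.map_sub₂, hyN ξ hξ, sub_self]
    exact ⟨x, by rw [hx, hc, if_pos hk, sub_add_cancel]⟩
  -- Removing the `x₀`-component makes `y` tangent at `x₀`; it is restored through `A z₀ = x₀`.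
  · obtain ⟨x, hx⟩ := hrange (y - (k * factorForm n k x₀ y) • x₀) (fun _ => by
      rw [map_sub, map_smul, hx₀.1 hk, smul_eq_mul]
      field_simp
      ring) fun ξ hξ => by
      rw [LinearMap.map_sub₂, LinearMap.map_smul₂, hyN ξ hξ, hN hξ hk, smul_zero, sub_zero]
    refine ⟨x + (k * factorForm n k x₀ y) • z₀, ?_⟩
    rw [map_add, map_smul, hx, hAz₀ hk, hck hk, add_zero, sub_add_cancel]

end Embedding

/-! ### Derivatives of bilinear forms, and a linear second-order equation -/

section Bilinear

variable {E : Type*} [NormedAddCommGroup E] [NormedSpace ℝ E] [FiniteDimensional ℝ E]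

theorem hasFDerivAt_bilinForm (B : LinearMap.BilinForm ℝ E) (p : E × E) :
    ∃ B' : E × E →L[ℝ] ℝ, HasFDerivAt (fun q : E × E => B q.1 q.2) B' p ∧
      ∀ q, B' q = B p.1 q.2 + B q.1 p.2 :=
  ⟨_, (LinearMap.toContinuousBilinearMap B).isBoundedBilinearMap.hasFDerivAt p, fun _ => rfl⟩

theorem hasDerivAt_bilinForm (B : LinearMap.BilinForm ℝ E) {x y : ℝ → E} {x' y' : E} {t : ℝ}
    (hx : HasDerivAt x x' t) (hy : HasDerivAt y y' t) :
    HasDerivAt (fun s => B (x s) (y s)) (B (x t) y' + B x' (y t)) t := by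
  obtain ⟨B', hB, hB'⟩ := hasFDerivAt_bilinForm B (x t, y t)
  have h := hB.comp_hasDerivAt t (hx.prodMk hy)
  rw [hB'] at h
  exact h

end Bilinear

/-- The zero solution of `u'' = σ u` is determined by its initial values. -/
theorem eq_zero_of_hasDerivAt_mul {σ : ℝ} {u v : ℝ → ℝ} (hu : ∀ t, HasDerivAt u (v t) t)
    (hv : ∀ t, HasDerivAt v (σ * u t) t) (hu0 : u 0 = 0) (hv0 : v 0 = 0) (t : ℝ) : u t = 0 := by
  let F : ℝ × ℝ →L[ℝ] ℝ × ℝ :=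
    (ContinuousLinearMap.snd ℝ ℝ ℝ).prod (σ • ContinuousLinearMap.fst ℝ ℝ ℝ)
  have h := ODE_solution_unique_univ (v := fun _ x => F x) (s := fun _ => Set.univ)
    (K := ‖F‖₊) (f := fun t => (u t, v t)) (g := fun _ => 0) (t₀ := 0)
    (fun _ => F.lipschitz.lipschitzOnWith)
    (fun t => ⟨(hu t).prodMk (hv t), trivial⟩)
    (fun t => ⟨by rw [map_zero]; exact hasDerivAt_const t 0, trivial⟩)
    (by simp [hu0, hv0])
  exact congrArg Prod.fst (congrFun h t)

/-! ### Geodesics of space forms and the span of a totally geodesic submanifold -/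

section Geodesic

variable {n : ℕ} {k : ℝ}

/-- A geodesic of constant speed solves the linear equation `c'' = -k ⟨c', c'⟩ c`. -/
theorem IsGeodesic.deriv_deriv_eq {c : ℝ → Factor n k} (hc : IsGeodesic n k c) {s : ℝ}
    (hs : ∀ t, factorForm n k (deriv c t) (deriv c t) = s) (t : ℝ) :
    deriv (deriv c) t = (-(k * s)) • c t := by
  have hc1 : ∀ t, HasDerivAt c (deriv c t) t := fun t =>
    (hc.contDiff.differentiable (by simp) t).hasDerivAt
  have hc2 : ∀ t, HasDerivAt (deriv c) (deriv (deriv c) t) t := fun t =>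
    (((contDiff_infty_iff_deriv.mp hc.contDiff).2).differentiable (by simp) t).hasDerivAt
  rw [eq_smul_of_normal (hc.mem t) (hc.normal_acceleration t)]
  by_cases hk : k = 0
  · simp [hk]
  have h1 : ∀ t, factorForm n k (deriv c t) (c t) = 0 := by
    intro t
    have h := hasDerivAt_bilinForm (factorForm n k) (hc1 t) (hc1 t)
    have hconst : (fun s => factorForm n k (c s) (c s)) = fun _ => 1 / k :=
      funext fun s => (hc.mem s).1 hk
    rw [hconst] at h
    have h0 := h.unique (hasDerivAt_const t (1 / k))
    rw [factorForm_comm (c t)] at h0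
    linarith
  -- Differentiating `⟨c', c⟩ = 0` gives `⟨c'', c⟩ = -⟨c', c'⟩`.
  have h2 : factorForm n k (deriv (deriv c) t) (c t) = -s := by
    have h := hasDerivAt_bilinForm (factorForm n k) (hc2 t) (hc1 t)
    rw [funext h1] at h
    have h0 := h.unique (hasDerivAt_const t (0 : ℝ))
    rw [hs] at h0
    linarith
  rw [h2]
  congr 1
  ring

/-- `J ∘ γ` is again a geodesic of the same constant speed, so its pairing with `ξ` obeys a linear
second-order equation; the conditions on `ξ` at time `0` make the initial data of the shifted
pairing vanish. -/
theorem IsTotallyGeodesicEmbedding.factorForm_comp_eq {d : ℕ} {J : Factor d k → Factor n k}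
    (hJ : IsTotallyGeodesicEmbedding d n k J) {γ : ℝ → Factor d k} (hγ : IsGeodesic d k γ) {s : ℝ}
    (hs : ∀ t, factorForm d k (deriv γ t) (deriv γ t) = s) {ξ : Factor n k}
    (hξ0 : k ≠ 0 → factorForm n k (J (γ 0)) ξ = 0)
    (hξ : ∀ X ∈ spaceFormTangent (γ 0), factorForm n k (fderiv ℝ J (γ 0) X) ξ = 0) (t : ℝ) :
    factorForm n k (J (γ t)) ξ = factorForm n k (J (γ 0)) ξ := by
  have hγ1 : ∀ t, HasDerivAt γ (deriv γ t) t := fun t =>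
    (hγ.contDiff.differentiable (by simp) t).hasDerivAt
  have hγT : ∀ t, deriv γ t ∈ spaceFormTangent (γ t) := by
    intro t hk
    have h := hasDerivAt_bilinForm (factorForm d k) (hγ1 t) (hγ1 t)
    have hconst : (fun s => factorForm d k (γ s) (γ s)) = fun _ => 1 / k :=
      funext fun s => (hγ.mem s).1 hk
    rw [hconst] at h
    have h0 := h.unique (hasDerivAt_const t (1 / k))
    rw [factorForm_comm (deriv γ t)] at h0
    linarith
  have hc := hJ.totallyGeodesic γ hγ
  have hc1 : ∀ t, HasDerivAt (J ∘ γ) (fderiv ℝ J (γ t) (deriv γ t)) t := fun t =>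
    ((hJ.contDiff.differentiable (by simp) (γ t)).hasFDerivAt).comp_hasDerivAt t (hγ1 t)
  have hcs : ∀ t, factorForm n k (deriv (J ∘ γ) t) (deriv (J ∘ γ) t) = s := by
    intro t
    rw [(hc1 t).deriv, hJ.isometric _ (hγ.mem t) _ (hγT t) _ (hγT t), hs]
  have hc2 : ∀ t, HasDerivAt (deriv (J ∘ γ)) ((-(k * s)) • (J ∘ γ) t) t := fun t => by
    rw [← hc.deriv_deriv_eq hcs t]
    exact (((contDiff_infty_iff_deriv.mp hc.contDiff).2).differentiable (by simp) t).hasDerivAt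
  -- Subtracting the initial value leaves the equation homogeneous because of this product, which
  -- vanishes whether or not `k = 0`.
  have hk0 : k * factorForm n k (J (γ 0)) ξ = 0 :=
    mul_eq_zero.mpr (or_iff_not_imp_left.mpr hξ0)
  have hu : ∀ t, HasDerivAt
      (fun t => factorForm n k ((J ∘ γ) t) ξ - factorForm n k (J (γ 0)) ξ)
      (factorForm n k (deriv (J ∘ γ) t) ξ) t := by
    intro t
    have h := hasDerivAt_bilinForm (factorForm n k) (hc1 t) (hasDerivAt_const t ξ)
    rw [map_zero, zero_add, ← (hc1 t).deriv] at h
    exact h.sub_const _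
  have hv : ∀ t, HasDerivAt (fun t => factorForm n k (deriv (J ∘ γ) t) ξ)
      (-(k * s) * (factorForm n k ((J ∘ γ) t) ξ - factorForm n k (J (γ 0)) ξ)) t := by
    intro t
    have h := hasDerivAt_bilinForm (factorForm n k) (hc2 t) (hasDerivAt_const t ξ)
    rw [map_zero, zero_add, LinearMap.map_smul₂, smul_eq_mul] at h
    convert h using 1
    linear_combination s * hk0
  have := eq_zero_of_hasDerivAt_mul hu hv (sub_self _)
    (by rw [(hc1 0).deriv]; exact hξ _ (hγT 0)) t
  exact sub_eq_zero.mp this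

/-- The geodesic `t ↦ C t • x₀ + S t • v`, where `(C, S)` is `(cos, sin)` or `(cosh, sinh)`. -/
theorem isGeodesic_of_trig (hk : k ≠ 0) {x₀ v : Factor n k} (hx₀ : x₀ ∈ spaceForm n k)
    (hv : v ∈ spaceFormTangent x₀) {σ : ℝ}
    (hvv : factorForm n k v v = σ / k) {C S : ℝ → ℝ} (hCd : ContDiff ℝ ∞ C)
    (hSd : ContDiff ℝ ∞ S) (hC : ∀ t, HasDerivAt C (-σ * S t) t)
    (hS : ∀ t, HasDerivAt S (C t) t) (hCS : ∀ t, C t ^ 2 + σ * S t ^ 2 = 1)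
    (hpos : k < 0 → ∀ t, 0 < C t) :
    IsGeodesic n k (fun t => C t • x₀ + S t • v) ∧
      ∀ t, factorForm n k (deriv (fun t => C t • x₀ + S t • v) t)
        (deriv (fun t => C t • x₀ + S t • v) t) = σ / k := by
  have hd1 : deriv (fun t => C t • x₀ + S t • v) = fun t => (-σ * S t) • x₀ + C t • v :=
    funext fun t => (((hC t).smul_const x₀).add ((hS t).smul_const v)).deriv
  have hd2 : ∀ t, deriv (fun t => (-σ * S t) • x₀ + C t • v) t =
      -σ • (C t • x₀ + S t • v) := fun t =>
    ((((hS t).const_mul (-σ)).smul_const x₀).add ((hC t).smul_const v)).deriv.trans (by module)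
  have hform : ∀ a b, factorForm n k (a • x₀ + b • v) (a • x₀ + b • v) =
      a ^ 2 * (1 / k) + b ^ 2 * (σ / k) := by
    intro a b
    simp only [map_add, map_smul, LinearMap.add_apply, LinearMap.smul_apply, smul_eq_mul]
    rw [hx₀.1 hk, hvv, factorForm_comm v x₀, hv hk]
    ring
  have hmem : ∀ t, C t • x₀ + S t • v ∈ spaceForm n k := by
    intro t
    have h1 : factorForm n k (C t • x₀ + S t • v) (C t • x₀ + S t • v) = 1 / k := by
      rw [hform]
      linear_combination (1 / k) * hCS t
    rcases lt_or_gt_of_ne hk with h | h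
    · rw [mem_spaceForm_iff_of_neg h hx₀]
      refine ⟨h1, ?_⟩
      rw [LinearMap.map_add₂, LinearMap.map_smul₂, LinearMap.map_smul₂, hx₀.1 hk,
        factorForm_comm v x₀, hv hk, smul_zero, add_zero, smul_eq_mul]
      exact mul_neg_of_pos_of_neg (hpos h t) (one_div_neg.mpr h)
    · exact (mem_spaceForm_iff_of_pos h).mpr h1
  refine ⟨⟨(hCd.smul contDiff_const).add (hSd.smul contDiff_const), hmem, fun t X hX => ?_⟩,
    fun t => ?_⟩
  · rw [hd1, hd2, LinearMap.map_smul₂, hX hk, smul_zero]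
  · rw [hd1, hform]
    linear_combination (σ / k) * hCS t

/-- Any two points of a space form, other than a zero-dimensional sphere, are joined by a geodesic
of constant speed. -/
theorem exists_geodesic {x₀ x : Factor n k} (hx₀ : x₀ ∈ spaceForm n k) (hx : x ∈ spaceForm n k)
    (hn : 0 < k → n ≠ 0) :
    ∃ γ : ℝ → Factor n k, IsGeodesic n k γ ∧ γ 0 = x₀ ∧ (∃ t, γ t = x) ∧
      ∃ s, ∀ t, factorForm n k (deriv γ t) (deriv γ t) = s := by
  by_cases hxx : x = x₀
  · subst hxx
    refine ⟨fun _ => x, ⟨contDiff_const, fun _ => hx, fun t X _ => ?_⟩, rfl, ⟨0, rfl⟩, 0,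
      fun t => ?_⟩
    · simp
    · simp
  by_cases hk : k = 0
  · have hd1 : deriv (fun t : ℝ => x₀ + t • (x - x₀)) = fun _ => x - x₀ := by
      funext t
      have h := ((hasDerivAt_id t).smul_const (x - x₀)).const_add x₀
      rw [one_smul] at h
      exact h.deriv
    refine ⟨fun t => x₀ + t • (x - x₀), ⟨?_, ?_, ?_⟩, by simp, ⟨1, by simp⟩,
      factorForm n k (x - x₀) (x - x₀), fun t => by rw [hd1]⟩
    · exact contDiff_const.add (contDiff_id.smul contDiff_const)
    · exact fun t => ⟨fun h => absurd hk h, fun h => absurd hk h.ne⟩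
    · intro t X _
      rw [hd1, deriv_const, LinearMap.map_zero₂]
  -- `c` is the cosine or hyperbolic cosine of the parameter at which the geodesic reaches `x`, and
  -- `w` is the component of `x` tangent at `x₀`.
  set c := k * factorForm n k x x₀ with hc
  set w := x - c • x₀ with hw
  have hxw : x = c • x₀ + w := by rw [hw]; abel
  have hwT : w ∈ spaceFormTangent x₀ := by
    intro _
    rw [hw, map_sub, map_smul, hx₀.1 hk, factorForm_comm x₀ x, hc, smul_eq_mul]
    field_simp
    ring
  have hww : factorForm n k w w = (1 - c ^ 2) / k := by
    have h1 := hx.1 hk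
    rw [hxw] at h1
    simp only [map_add, map_smul, LinearMap.add_apply, LinearMap.smul_apply, smul_eq_mul] at h1
    rw [hx₀.1 hk, factorForm_comm w x₀, hwT hk] at h1
    linear_combination h1
  have hwnn : 0 ≤ factorForm n k w w := by
    by_cases h : w = 0
    · rw [h, map_zero]
    · exact (factorForm_pos hx₀ hwT h).le
  have hnormalize : ∀ w ∈ spaceFormTangent x₀, w ≠ 0 → ∃ v ∈ spaceFormTangent x₀,
      factorForm n k v v = 1 / |k| ∧ w = √(|k| * factorForm n k w w) • v := by
    intro w hwT hw0
    have hp := mul_pos (abs_pos.mpr hk) (factorForm_pos hx₀ hwT hw0)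
    have hs := (Real.sqrt_pos.mpr hp).ne'
    refine ⟨(√(|k| * factorForm n k w w))⁻¹ • w, Submodule.smul_mem _ _ hwT, ?_, ?_⟩
    · rw [map_smul, LinearMap.map_smul₂, smul_eq_mul, smul_eq_mul, ← mul_assoc, ← mul_inv,
        Real.mul_self_sqrt hp.le]
      have := (factorForm_pos hx₀ hwT hw0).ne'
      have := (abs_pos.mpr hk).ne'
      field_simp
    · rw [smul_smul, mul_inv_cancel₀ hs, one_smul]
  rcases lt_or_gt_of_ne hk with hneg | hpos
  · have hc0 : 0 < c := mul_pos_of_neg_of_neg hneg ((mem_spaceForm_iff_of_neg hneg hx₀).mp hx).2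
    have hc1 : 1 ≤ c ^ 2 := by
      by_contra! h
      have := div_neg_of_pos_of_neg (sub_pos.mpr h) hneg
      linarith
    have hw0 : w ≠ 0 := by
      intro h
      rw [h, map_zero, eq_comm, div_eq_zero_iff, or_iff_left hk] at hww
      have : c = 1 := by nlinarith
      rw [h, this, one_smul, add_zero] at hxw
      exact hxx hxw
    obtain ⟨v, hv, hvv, hwv⟩ := hnormalize w hwT hw0
    have hkw : |k| * factorForm n k w w = c ^ 2 - 1 := by
      rw [hww, abs_of_neg hneg]
      field_simp
      ring
    rw [hkw] at hwv
    obtain ⟨h1, h2⟩ := isGeodesic_of_trig hk hx₀ hv (σ := -1)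
      (by rw [hvv, abs_of_neg hneg, one_div_neg_eq_neg_one_div, neg_div]) Real.contDiff_cosh
      Real.contDiff_sinh (fun t => by simpa using Real.hasDerivAt_cosh t) Real.hasDerivAt_sinh
      (fun t => by rw [Real.cosh_sq]; ring) fun _ t => Real.cosh_pos t
    refine ⟨_, h1, by simp, ⟨Real.arsinh (√(c ^ 2 - 1)), ?_⟩, _, h2⟩
    rw [Real.cosh_arsinh, Real.sinh_arsinh, Real.sq_sqrt (by linarith), add_sub_cancel,
      Real.sqrt_sq hc0.le, ← hwv, ← hxw]
  · have hc1 : c ^ 2 ≤ 1 := by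
      by_contra! h
      have := div_neg_of_neg_of_pos (sub_neg.mpr h) hpos
      linarith
    have hkw : |k| * factorForm n k w w = 1 - c ^ 2 := by
      rw [hww, abs_of_pos hpos]
      field_simp
    obtain ⟨v, hv, hvv, hwv⟩ : ∃ v ∈ spaceFormTangent x₀,
        factorForm n k v v = 1 / |k| ∧ w = √(|k| * factorForm n k w w) • v := by
      by_cases hw0 : w = 0
      -- Here `x` is the antipode of `x₀`, and any initial direction works; one exists because `n ≠
      -- 0`.
      · obtain ⟨u, hu⟩ : ∃ u : spaceFormTangent x₀, u ≠ 0 := by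
          rw [← Module.finrank_pos_iff_exists_ne_zero (R := ℝ), finrank_spaceFormTangent hx₀]
          exact Nat.pos_of_ne_zero (hn hpos)
        obtain ⟨v, hv, hvv, -⟩ := hnormalize u u.2 fun h => hu (Subtype.ext h)
        exact ⟨v, hv, hvv, by rw [hw0]; simp⟩
      · exact hnormalize w hwT hw0
    rw [hkw] at hwv
    obtain ⟨h1, h2⟩ := isGeodesic_of_trig hk hx₀ hv (σ := 1)
      (by rw [hvv, abs_of_pos hpos]) Real.contDiff_cos
      Real.contDiff_sin (fun t => by simpa using Real.hasDerivAt_cos t) Real.hasDerivAt_sin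
      (fun t => by rw [one_mul, Real.cos_sq_add_sin_sq]) fun h => absurd h hpos.not_gt
    refine ⟨_, h1, by simp, ⟨Real.arccos c, ?_⟩, _, h2⟩
    rw [Real.cos_arccos (by nlinarith) (by nlinarith), Real.sin_arccos, ← hwv, ← hxw]

/-- A zero-dimensional sphere is a pair of antipodal points. -/
theorem finite_spaceForm_zero (hk : 0 < k) : (spaceForm 0 k).Finite := by
  rcases Set.eq_empty_or_nonempty (spaceForm 0 k) with h | ⟨x₀, hx₀⟩
  · rw [h]; exact Set.finite_empty
  refine (Set.toFinite {x₀, -x₀}).subset fun x hx => ?_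
  have hT : spaceFormTangent x₀ = ⊥ :=
    Submodule.finrank_eq_zero.mp (finrank_spaceFormTangent hx₀)
  have hw : x - (k * factorForm 0 k x₀ x) • x₀ ∈ spaceFormTangent x₀ := by
    intro _
    rw [map_sub, map_smul, hx₀.1 hk.ne', smul_eq_mul]
    field_simp
    ring
  rw [hT, Submodule.mem_bot, sub_eq_zero] at hw
  generalize k * factorForm 0 k x₀ x = c at hw
  have h1 := hx.1 hk.ne'
  rw [hw, map_smul, LinearMap.map_smul₂, hx₀.1 hk.ne', smul_eq_mul, smul_eq_mul] at h1
  have h2 : c * c = 1 := by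
    field_simp at h1
    linarith
  rcases mul_self_eq_one_iff.mp h2 with h | h
  · left; rw [hw, h, one_smul]
  · right; rw [hw, h, neg_one_smul]; rfl

/-- A totally geodesic submanifold is contained in an affine subspace of the right codimension. -/
theorem IsTotallyGeodesicEmbedding.exists_orthogonal {d r : ℕ} {J : Factor d k → Factor n k}
    (hJ : IsTotallyGeodesicEmbedding d n k J) (hdr : d + r = n) (hd : 0 < k → d ≠ 0)
    {x₀ : Factor d k} (hx₀ : x₀ ∈ spaceForm d k) :
    ∃ N : Submodule ℝ (Factor n k), Module.finrank ℝ N = r ∧ ∀ ξ ∈ N,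
      (k ≠ 0 → factorForm n k (J x₀) ξ = 0) ∧
      ∀ x ∈ spaceForm d k, factorForm n k (J x) ξ = factorForm n k (J x₀) ξ := by
  classical
  set W₀ : Submodule ℝ (Factor n k) := if k = 0 then ⊥ else Submodule.span ℝ {J x₀} with hW₀
  set W₁ : Submodule ℝ (Factor n k) :=
    (spaceFormTangent x₀).map (fderiv ℝ J x₀).toLinearMap with hW₁
  have h0 : Module.finrank ℝ W₀ ≤ extraDim k := by
    by_cases hk : k = 0
    · rw [hW₀, if_pos hk, finrank_bot]
      exact Nat.zero_le _
    · rw [hW₀, if_neg hk]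
      exact (finrank_span_le_card _).trans (by simp [extraDim_eq_one hk])
  have h1 : Module.finrank ℝ W₁ ≤ d :=
    (Submodule.finrank_map_le _ _).trans (finrank_spaceFormTangent hx₀).le
  have h2 := Submodule.finrank_add_le_finrank_add_finrank W₀ W₁
  -- Upper bounds on the dimensions suffice: `W₀ ⊔ W₁` has dimension at most `extraDim k + d`, so
  -- its complement has dimension at least `r`.
  obtain ⟨N, hN, hNr⟩ := exists_submodule_le_finrank_eq
    ((factorForm n k).orthogonal (W₀ ⊔ W₁)) (r := r) (by
      rw [LinearMap.BilinForm.finrank_orthogonal factorForm_nondegenerate,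
        finrank_euclideanSpace_fin]
      omega)
  refine ⟨N, hNr, fun ξ hξ => ?_⟩
  have horth := LinearMap.BilinForm.mem_orthogonal_iff.mp (hN hξ)
  have hξ0 : k ≠ 0 → factorForm n k (J x₀) ξ = 0 := by
    intro hk
    refine horth _ (Submodule.mem_sup_left ?_)
    rw [hW₀, if_neg hk]
    exact Submodule.mem_span_singleton_self _
  refine ⟨hξ0, fun x hx => ?_⟩
  obtain ⟨γ, hγ, rfl, ⟨t, rfl⟩, s, hs⟩ := exists_geodesic hx₀ hx hd
  exact hJ.factorForm_comp_eq hγ hs hξ0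
    (fun X hX => horth _ (Submodule.mem_sup_right (Submodule.mem_map_of_mem hX))) t

end Geodesic

/-! ### Differentiation of vector-valued maps on a manifold -/

section Manifold

variable {H : Type*} [NormedAddCommGroup H] [NormedSpace ℝ H]
  {M : Type*} [TopologicalSpace M] [ChartedSpace H M]
  {E : Type*} [NormedAddCommGroup E] [NormedSpace ℝ E]
  {F : Type*} [NormedAddCommGroup F] [NormedSpace ℝ F]

theorem mfderiv_bilinForm [FiniteDimensional ℝ E] (B : LinearMap.BilinForm ℝ E) {ζ η : M → E}
    {p : M} (hζ : MDifferentiableAt 𝓘(ℝ, H) 𝓘(ℝ, E) ζ p)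
    (hη : MDifferentiableAt 𝓘(ℝ, H) 𝓘(ℝ, E) η p) (X : TangentSpace 𝓘(ℝ, H) p) :
    mfderiv 𝓘(ℝ, H) 𝓘(ℝ, ℝ) (fun q => B (ζ q) (η q)) p X =
      B (ζ p) (mfderiv 𝓘(ℝ, H) 𝓘(ℝ, E) η p X) + B (mfderiv 𝓘(ℝ, H) 𝓘(ℝ, E) ζ p X) (η p) := by
  obtain ⟨B', hB, hB'⟩ := hasFDerivAt_bilinForm B (ζ p, η p)
  have hpair : HasMFDerivAt 𝓘(ℝ, H) 𝓘(ℝ, E × E) (fun q => (ζ q, η q)) p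
      ((mfderiv 𝓘(ℝ, H) 𝓘(ℝ, E) ζ p).prod (mfderiv 𝓘(ℝ, H) 𝓘(ℝ, E) η p)) :=
    ⟨hζ.hasMFDerivAt.1.prodMk hη.hasMFDerivAt.1, hζ.hasMFDerivAt.2.prodMk hη.hasMFDerivAt.2⟩
  have h := hB.hasMFDerivAt.comp p hpair
  exact (DFunLike.congr_fun h.mfderiv X).trans (hB' _)

theorem mfderiv_linearMap_comp [FiniteDimensional ℝ E] (Q : E →ₗ[ℝ] F) {ζ : M → E} {p : M}
    (hζ : MDifferentiableAt 𝓘(ℝ, H) 𝓘(ℝ, E) ζ p) (X : TangentSpace 𝓘(ℝ, H) p) :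
    mfderiv 𝓘(ℝ, H) 𝓘(ℝ, F) (fun q => Q (ζ q)) p X =
      Q (mfderiv 𝓘(ℝ, H) 𝓘(ℝ, E) ζ p X) := by
  have h := (LinearMap.toContinuousLinearMap Q).hasFDerivAt.hasMFDerivAt.comp p hζ.hasMFDerivAt
  exact DFunLike.congr_fun h.mfderiv X

theorem mfderiv_eq_zero_of_eventually_eq {ζ : M → E} {p : M} {c : E}
    (h : ∀ᶠ q in nhds p, ζ q = c) (X : TangentSpace 𝓘(ℝ, H) p) :
    (mfderiv 𝓘(ℝ, H) 𝓘(ℝ, E) ζ p X : E) = 0 := by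
  have h1 : HasMFDerivAt 𝓘(ℝ, H) 𝓘(ℝ, E) ζ p 0 :=
    (hasMFDerivAt_const c p).congr_of_eventuallyEq h
  exact DFunLike.congr_fun h1.mfderiv X

/-- Composing with the identity minus a projection onto `Λ` gives a map that is locally zero. Where
`ζ` is not differentiable, `mfderiv` is zero by default. -/
theorem mfderiv_mem_of_eventually_mem [FiniteDimensional ℝ E] (Λ : Submodule ℝ E) {ζ : M → E}
    {p : M} (h : ∀ᶠ q in nhds p, ζ q ∈ Λ) (X : TangentSpace 𝓘(ℝ, H) p) :
    (mfderiv 𝓘(ℝ, H) 𝓘(ℝ, E) ζ p X : E) ∈ Λ := by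
  by_cases hζ : MDifferentiableAt 𝓘(ℝ, H) 𝓘(ℝ, E) ζ p
  · obtain ⟨g, hg⟩ := LinearMap.exists_leftInverse_of_injective Λ.subtype Λ.ker_subtype
    have hg' : ∀ z ∈ Λ, (g z : E) = z := fun z hz =>
      congrArg Subtype.val (LinearMap.congr_fun hg ⟨z, hz⟩)
    have h1 := mfderiv_linearMap_comp (LinearMap.id - Λ.subtype ∘ₗ g) hζ X
    have h2 : (mfderiv 𝓘(ℝ, H) 𝓘(ℝ, E)
        (fun q => (LinearMap.id - Λ.subtype ∘ₗ g : E →ₗ[ℝ] E) (ζ q)) p X : E) = 0 :=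
      mfderiv_eq_zero_of_eventually_eq (c := 0) (h.mono fun q hq => by simp [hg' _ hq]) X
    have h3 := sub_eq_zero.mp (h1.symm.trans h2)
    exact (show (mfderiv 𝓘(ℝ, H) 𝓘(ℝ, E) ζ p X : E) = _ from h3) ▸ (g _).2
  · rw [mfderiv_zero_of_not_mdifferentiableAt hζ]
    exact Λ.zero_mem

/-- A map with vanishing derivative on an open set is locally constant there. -/
theorem eventually_eq_of_mfderiv_eq_zero [IsManifold 𝓘(ℝ, H) 1 M] {g : M → E} {U : Set M}
    (hU : IsOpen U) (hg : ∀ q ∈ U, MDifferentiableAt 𝓘(ℝ, H) 𝓘(ℝ, E) g q)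
    (hg' : ∀ q ∈ U, ∀ X : TangentSpace 𝓘(ℝ, H) q, (mfderiv 𝓘(ℝ, H) 𝓘(ℝ, E) g q X : E) = 0)
    {p : M} (hp : p ∈ U) : ∀ᶠ q in nhds p, g q = g p := by
  set φ := chartAt H p with hφ
  have hps : p ∈ φ.source := mem_chart_source H p
  have hopen : IsOpen (φ.target ∩ φ.symm ⁻¹' U) := φ.isOpen_inter_preimage_symm hU
  have hmem : φ p ∈ φ.target ∩ φ.symm ⁻¹' U :=
    ⟨φ.map_source hps, by rw [Set.mem_preimage, φ.left_inv hps]; exact hp⟩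
  obtain ⟨ε, hε, hball⟩ := Metric.isOpen_iff.mp hopen _ hmem
  have hd : ∀ y ∈ Metric.ball (φ p) ε, HasFDerivAt (g ∘ φ.symm) (0 : H →L[ℝ] E) y := by
    intro y hy
    have h1 : MDifferentiableAt 𝓘(ℝ, H) 𝓘(ℝ, H) φ.symm y :=
      mdifferentiableAt_atlas_symm (chart_mem_atlas H p) (hball hy).1
    have h2 := (hg _ (hball hy).2).hasMFDerivAt.comp y h1.hasMFDerivAt
    exact h2.hasFDerivAt.congr_fderiv (ContinuousLinearMap.ext fun X => hg' _ (hball hy).2 _)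
  have hconst : ∀ y ∈ Metric.ball (φ p) ε, (g ∘ φ.symm) y = (g ∘ φ.symm) (φ p) := by
    intro y hy
    exact (convex_ball (φ p) ε).is_const_of_fderivWithin_eq_zero
      (fun z hz => (hd z hz).differentiableAt.differentiableWithinAt)
      (fun z hz => by
        rw [fderivWithin_of_isOpen Metric.isOpen_ball hz, (hd z hz).fderiv])
      hy (Metric.mem_ball_self hε)
  have hnhds : φ.source ∩ φ ⁻¹' Metric.ball (φ p) ε ∈ nhds p :=
    (φ.isOpen_inter_preimage Metric.isOpen_ball).mem_nhds ⟨hps, Metric.mem_ball_self hε⟩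
  filter_upwards [hnhds] with q hq
  have := hconst _ hq.2
  rwa [Function.comp_apply, Function.comp_apply, φ.left_inv hq.1, φ.left_inv hps] at this

theorem eq_of_mfderiv_eq_zero [IsManifold 𝓘(ℝ, H) 1 M] [PreconnectedSpace M] {g : M → E}
    (hg : MDifferentiable 𝓘(ℝ, H) 𝓘(ℝ, E) g)
    (hg' : ∀ q, ∀ X : TangentSpace 𝓘(ℝ, H) q, (mfderiv 𝓘(ℝ, H) 𝓘(ℝ, E) g q X : E) = 0)
    (p q : M) : g p = g q :=
  ((IsLocallyConstant.iff_eventually_eq g).mpr fun _ =>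
    eventually_eq_of_mfderiv_eq_zero isOpen_univ (fun q _ => hg q) (fun q _ => hg' q)
      (Set.mem_univ _)).apply_eq_of_preconnectedSpace p q

end Manifold

/-! ### The product form and the inclusion of one factor -/

section Product

variable {l : ℕ} {n : Fin l → ℕ} {k : Fin l → ℝ}

variable (n k) in
/-- The inclusion of the `i`-th factor of the ambient space. -/
abbrev factorIncl (i : Fin l) : Factor (n i) (k i) →ₗ[ℝ] Ambient n k :=
  LinearMap.single ℝ (fun j => Factor (n j) (k j)) i

theorem ambientForm_comm (x y : Ambient n k) : ambientForm n k x y = ambientForm n k y x := by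
  simp only [ambientForm_apply]
  exact Finset.sum_congr rfl fun j _ => factorForm_comm _ _

theorem ambientForm_factorIncl (i : Fin l) (x : Ambient n k) (ξ : Factor (n i) (k i)) :
    ambientForm n k x (factorIncl n k i ξ) = factorForm (n i) (k i) (x i) ξ := by
  rw [ambientForm_apply, Finset.sum_eq_single i]
  · simp
  · intro j _ hj
    simp [hj]
  · simp

theorem proj_eq_factorIncl (i : Fin l) (x : Ambient n k) :
    proj n k i x = factorIncl n k i (x i) := rfl

theorem eq_factorIncl_of_forall_ne {i : Fin l} {x : Ambient n k} (h : ∀ j ≠ i, x j = 0) :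
    x = factorIncl n k i (x i) := by
  funext j
  by_cases hj : j = i
  · subst hj
    simp
  · rw [h j hj]
    simp [hj]

end Product

/-! ### Reduction of codimension in terms of constant normal vectors -/

namespace IsometricImmersion

variable {l : ℕ} {n : Fin l → ℕ} {k : Fin l → ℝ} {m : ℕ} {M : Type*}
  [TopologicalSpace M] [ChartedSpace (EuclideanSpace ℝ (Fin m)) M]
  [Bundle.RiemannianBundle (fun x : M => TangentSpace (𝓡 m) x)]
  (f : IsometricImmersion n k m M)

/-- Both projections are adjoints of inclusions, so testing against normal vectors replaces the
connection and `α` by plain derivatives in the ambient space. -/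
theorem normalMetric_toNormal_toTarget (p : M) (Z : Ambient n k) (η : f.normalSpace p) :
    f.normalMetric p (f.toNormal p (f.toTarget p Z)) η = ambientForm n k Z η :=
  (formAdjoint_spec _ _ _ _ _ _).trans (formAdjoint_spec _ _ _ _ _ _)

theorem eq_of_normalMetric_eq {p : M} {ξ η : f.normalSpace p}
    (h : ∀ v, f.normalMetric p ξ v = f.normalMetric p η v) : ξ = η := by
  refine sub_eq_zero.mp ((f.normalMetric_nondegenerate p).1 _ fun v => ?_)
  rw [LinearMap.map_sub₂, h, sub_self]

theorem toNormal_toTarget_of_mem {p : M} {Z : Ambient n k} (hZ : Z ∈ f.normalSpace p) :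
    f.toNormal p (f.toTarget p Z) = ⟨Z, hZ⟩ :=
  f.eq_of_normalMetric_eq fun v => f.normalMetric_toNormal_toTarget p Z v

theorem normalMetric_tensorT (i : Fin l) (p : M) (ξ η : f.normalSpace p) :
    f.normalMetric p (f.tensorT i p ξ) η =
      factorForm (n i) (k i) ((ξ : Ambient n k) i) ((η : Ambient n k) i) := by
  refine (formAdjoint_spec (f.normalMetric p) (f.normalMetric_nondegenerate p) (f.targetMetric p)
    (f.tensorK i p) (f.tensorK i p ξ) η).trans ?_
  change ambientForm n k (proj n k i ξ) (proj n k i η) = _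
  rw [proj_eq_factorIncl, proj_eq_factorIncl, ambientForm_factorIncl]
  simp

/-- Since `⟨T_i ξ, ξ⟩ = ⟨ξ_i, ξ_i⟩`, a fixed vector has other components whose squares sum to zero,
and each of these is nonnegative on tangent vectors. -/
theorem mem_kerIdSubT_iff {i : Fin l} {p : M} {ξ : f.normalSpace p} :
    ξ ∈ f.kerIdSubT i p ↔ ∀ j ≠ i, (ξ : Ambient n k) j = 0 := by
  rw [kerIdSubT, LinearMap.mem_ker, LinearMap.sub_apply, LinearMap.id_apply, sub_eq_zero]
  constructor
  · intro h
    have h1 : ambientForm n k ξ ξ =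
        factorForm (n i) (k i) ((ξ : Ambient n k) i) ((ξ : Ambient n k) i) := by
      rw [← f.normalMetric_tensorT, ← h]
      rfl
    have hT : ∀ j, (ξ : Ambient n k) j ∈ spaceFormTangent (f.toFun p j) := fun j =>
      ξ.2.1 j trivial
    have hnn : ∀ j, 0 ≤ factorForm (n j) (k j) ((ξ : Ambient n k) j) ((ξ : Ambient n k) j) := by
      intro j
      by_cases h0 : (ξ : Ambient n k) j = 0
      · rw [h0, map_zero]
      · exact (factorForm_pos (f.mem p j) (hT j) h0).le
    rw [ambientForm_apply, ← Finset.add_sum_erase _ _ (Finset.mem_univ i), add_eq_left,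
      Finset.sum_eq_zero_iff_of_nonneg fun j _ => hnn j] at h1
    intro j hj
    by_contra h0
    exact (factorForm_pos (f.mem p j) (hT j) h0).ne'
      (h1 j (Finset.mem_erase.mpr ⟨hj, Finset.mem_univ j⟩))
  · intro h
    refine f.eq_of_normalMetric_eq fun v => ?_
    rw [normalMetric_tensorT]
    change ambientForm n k ξ v = _
    rw [eq_factorIncl_of_forall_ne h, ambientForm_comm, ambientForm_factorIncl, factorForm_comm]
    simp

theorem mdifferentiable : MDifferentiable (𝓡 m) 𝓘(ℝ, Ambient n k) f.toFun :=
  f.contMDiff.mdifferentiable (by simp)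

/-- The `i`-th component of `f` takes values in an affine subspace orthogonal to a subspace of
dimension `r`, which is linear if `k_i ≠ 0`. -/
def HasConstantNormals (i : Fin l) (r : ℕ) : Prop :=
  ∃ N : Submodule ℝ (Factor (n i) (k i)), Module.finrank ℝ N = r ∧ ∀ ξ ∈ N,
    (∀ p, ξ ∈ spaceFormTangent (f.toFun p i)) ∧
    ∀ p q, factorForm (n i) (k i) (f.toFun p i) ξ = factorForm (n i) (k i) (f.toFun q i) ξ

theorem HasConstantNormals.codimReducedBy [Nonempty M] {i : Fin l} {r : ℕ}
    (h : f.HasConstantNormals i r) : f.CodimReducedBy i r := by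
  obtain ⟨N, hNr, hN⟩ := h
  obtain ⟨p₀⟩ := ‹Nonempty M›
  have hle : N ≤ spaceFormTangent (f.toFun p₀ i) := fun ξ hξ => (hN ξ hξ).1 p₀
  have hrn : r ≤ n i :=
    hNr ▸ (Submodule.finrank_mono hle).trans_eq (finrank_spaceFormTangent (f.mem p₀ i))
  obtain ⟨J, hJ, himg⟩ := exists_isTotallyGeodesicEmbedding (f.mem p₀ i) hle (d := n i - r)
    (by omega)
  refine ⟨n i - r, _, by omega, ⟨J, hJ, rfl⟩, ?_⟩
  rintro _ ⟨p, rfl⟩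
  exact ⟨f.mem p, himg _ (f.mem p i) fun ξ hξ => (hN ξ hξ).2 p p₀⟩

theorem CodimReducedBy.hasConstantNormals [ConnectedSpace M] {i : Fin l} {r : ℕ}
    (h : f.CodimReducedBy i r) : f.HasConstantNormals i r := by
  obtain ⟨d, S, hdr, ⟨J, hJ, rfl⟩, hf⟩ := h
  obtain ⟨p₀⟩ := (inferInstance : Nonempty M)
  have hfJ : ∀ p, f.toFun p i ∈ J '' spaceForm d (k i) := fun p => (hf ⟨p, rfl⟩).2
  by_cases hd : 0 < k i → d ≠ 0
  · obtain ⟨x₀, hx₀, hJx₀⟩ := hfJ p₀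
    obtain ⟨N, hNr, hN⟩ := hJ.exists_orthogonal hdr hd hx₀
    have hval : ∀ p, ∀ ξ ∈ N, factorForm (n i) (k i) (f.toFun p i) ξ =
        factorForm (n i) (k i) (J x₀) ξ := by
      intro p ξ hξ
      obtain ⟨x, hx, hJx⟩ := hfJ p
      rw [← hJx, (hN ξ hξ).2 x hx]
    exact ⟨N, hNr, fun ξ hξ => ⟨fun p hk =>
      (hval p ξ hξ).trans ((hN ξ hξ).1 hk), fun p q => (hval p ξ hξ).trans (hval q ξ hξ).symm⟩⟩
  -- A zero-dimensional sphere is not joined by geodesics, but it is finite, so `f_i` is constant on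
  -- the connected `M`. The whole tangent space then serves as `N`, with `r = n_i` because `d = 0`.
  · push Not at hd
    obtain ⟨hk, rfl⟩ := hd
    have hfin : (J '' spaceForm 0 (k i)).Finite := (finite_spaceForm_zero hk).image J
    have hcont : Continuous fun p => f.toFun p i :=
      (continuous_apply i).comp f.contMDiff.continuous
    have hconst : ∀ p, f.toFun p i = f.toFun p₀ i := fun p =>
      hfin.countable.isTotallyDisconnected (Set.range fun p => f.toFun p i)
        (Set.range_subset_iff.mpr hfJ) (isPreconnected_range hcont) ⟨p, rfl⟩ ⟨p₀, rfl⟩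
    refine ⟨spaceFormTangent (f.toFun p₀ i), ?_, fun ξ hξ => ⟨fun p => ?_,
      fun p q => by rw [hconst p, hconst q]⟩⟩
    · rw [finrank_spaceFormTangent (f.mem p₀ i), ← hdr, zero_add]
    · rw [hconst p]
      exact hξ

end IsometricImmersion

/-! ### Constant normal vectors and parallel subbundles -/

namespace IsometricImmersion

/-- The derivative of a constant pairing is zero; the default value of `mfderiv` covers points where
`ζ` is not differentiable, so no regularity is required. -/
theorem ambientForm_factorIncl_flatDeriv {l : ℕ} {n : Fin l → ℕ} {k : Fin l → ℝ} {m : ℕ}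
    {M : Type*} [TopologicalSpace M] [ChartedSpace (EuclideanSpace ℝ (Fin m)) M] {i : Fin l} {ξ : Factor (n i) (k i)} {c : ℝ}
    {ζ : M → Ambient n k} {p : M}
    (hζ : ∀ᶠ q in nhds p, factorForm (n i) (k i) (ζ q i) ξ = c) (X : TangentSpace (𝓡 m) p) :
    ambientForm n k (flatDeriv ζ p X) (factorIncl n k i ξ) = 0 := by
  by_cases hd : MDifferentiableAt (𝓡 m) 𝓘(ℝ, Ambient n k) ζ p
  · have h1 := mfderiv_linearMap_comp ((ambientForm n k).flip (factorIncl n k i ξ)) hd X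
    exact h1.symm.trans (mfderiv_eq_zero_of_eventually_eq (c := c)
      (hζ.mono fun q hq => (ambientForm_factorIncl i (ζ q) ξ).trans hq) X)
  · rw [flatDeriv, mfderiv_zero_of_not_mdifferentiableAt hd]
    exact LinearMap.map_zero₂ _ _

variable {l : ℕ} {n : Fin l → ℕ} {k : Fin l → ℝ} {m : ℕ} {M : Type*}
  [TopologicalSpace M] [ChartedSpace (EuclideanSpace ℝ (Fin m)) M]
  [Bundle.RiemannianBundle (fun x : M => TangentSpace (𝓡 m) x)]
  (f : IsometricImmersion n k m M)

theorem factorIncl_mem_normalSpace {i : Fin l} {ξ : Factor (n i) (k i)}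
    (hT : ∀ p, ξ ∈ spaceFormTangent (f.toFun p i))
    (hc : ∀ p q, factorForm (n i) (k i) (f.toFun p i) ξ = factorForm (n i) (k i) (f.toFun q i) ξ)
    (p : M) : factorIncl n k i ξ ∈ f.normalSpace p := by
  refine ⟨fun j _ => ?_, fun X => ?_⟩
  · by_cases h : j = i
    · subst h
      simpa using hT p
    · simp [h]
  · exact ambientForm_factorIncl_flatDeriv (Filter.Eventually.of_forall fun q => hc q p) X

/-- The fibre of `L` is the same copy of `N` at every point, so a basis of `N` is a global frame. -/
theorem HasConstantNormals.exists_parallel [IsManifold (𝓡 m) ∞ M] {i : Fin l} {r : ℕ}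
    (h : f.HasConstantNormals i r) :
    ∃ L : ∀ p, Submodule ℝ (f.normalSpace p), f.IsNormalSubbundle r L ∧
      (∀ p, L p ≤ f.kerIdSubT i p ⊓ f.firstNormalSpaceOrth p) ∧ f.IsParallelNormal L := by
  obtain ⟨N, hNr, hN⟩ := h
  have hmem : ∀ p, ∀ ξ ∈ N, factorIncl n k i ξ ∈ f.normalSpace p := fun p ξ hξ =>
    f.factorIncl_mem_normalSpace (hN ξ hξ).1 (hN ξ hξ).2 p
  have hL : ∀ p, ∀ η : f.normalSpace p,
      η ∈ (N.map (factorIncl n k i)).comap (f.normalSpace p).subtype ↔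
        ∃ ξ ∈ N, factorIncl n k i ξ = η := fun p η => Iff.rfl
  have hinj : Function.Injective (factorIncl n k i) :=
    Pi.single_injective (M := fun j => Factor (n j) (k j)) i
  refine ⟨fun p => (N.map (factorIncl n k i)).comap (f.normalSpace p).subtype, ?_, ?_, ?_⟩
  · intro p
    let b := Module.finBasisOfFinrankEq ℝ N hNr
    refine ⟨Set.univ, isOpen_univ, Set.mem_univ p,
      fun a q => ⟨factorIncl n k i (b a), hmem q _ (b a).2⟩, fun a => contMDiffOn_const,
      fun q _ => ?_⟩
    let T : N →ₗ[ℝ] f.normalSpace q :=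
      (factorIncl n k i ∘ₗ N.subtype).codRestrict _ fun ξ => hmem q _ ξ.2
    have hT : (fun a => (⟨factorIncl n k i (b a), hmem q _ (b a).2⟩ : f.normalSpace q)) =
        T ∘ b := rfl
    have hTinj : Function.Injective T := fun ξ η h =>
      Subtype.ext (hinj (congrArg Subtype.val h))
    rw [hT]
    refine ⟨b.linearIndependent.map' T (LinearMap.ker_eq_bot.mpr hTinj), ?_⟩
    rw [Set.range_comp, ← Submodule.map_span, b.span_eq, Submodule.map_top]
    ext η
    rw [hL, LinearMap.mem_range]
    exact ⟨fun ⟨ξ, h⟩ => ⟨ξ, ξ.2, congrArg Subtype.val h⟩,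
      fun ⟨ξ, hξ, h⟩ => ⟨⟨ξ, hξ⟩, Subtype.ext h⟩⟩
  · rintro p η hη
    obtain ⟨ξ, hξ, hξη⟩ := (hL p η).mp hη
    refine ⟨f.mem_kerIdSubT_iff.mpr fun j hj => ?_, ?_⟩
    · rw [← hξη]
      simp [hj]
    · rw [SetLike.mem_coe, firstNormalSpaceOrth, LinearMap.BilinForm.mem_orthogonal_iff]
      intro ν hν
      change f.normalMetric p ν η = 0
      induction hν using Submodule.span_induction with
      | mem ν hν =>
        obtain ⟨X, Y, -, -, -, -, rfl⟩ := hν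
        refine (f.normalMetric_toNormal_toTarget p _ η).trans ?_
        rw [← hξη]
        -- `⟨α(X, Y), ξ⟩` is the derivative of `⟨f_* Y, ξ⟩ = 0`, since `ξ` is constant.
        refine ambientForm_factorIncl_flatDeriv (c := 0) (Filter.Eventually.of_forall fun q => ?_) X
        rw [← ambientForm_factorIncl]
        exact (hmem q ξ hξ).2 (Y q)
      | zero => exact LinearMap.map_zero₂ _ _
      | add ν ν' _ _ h h' => rw [LinearMap.map_add₂, h, h', add_zero]
      | smul c ν _ h => rw [LinearMap.map_smul₂, h, smul_zero]
  · intro U ξ hU _ hξ p hp X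
    have hD : flatDeriv (fun q => (ξ q : Ambient n k)) p X ∈ N.map (factorIncl n k i) :=
      mfderiv_mem_of_eventually_mem _ (Filter.eventually_of_mem (hU.mem_nhds hp) hξ) X
    have hDn : flatDeriv (fun q => (ξ q : Ambient n k)) p X ∈ f.normalSpace p := by
      obtain ⟨z, hz, h⟩ := hD
      rw [← h]
      exact hmem p z hz
    have := f.toNormal_toTarget_of_mem hDn
    rw [normalConnection, covDeriv, this]
    exact hD

theorem mdifferentiableAt_push [IsManifold (𝓡 m) ∞ M] {Y : ∀ q : M, TangentSpace (𝓡 m) q}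
    {U : Set M} (hU : IsOpen U) (hY : ContMDiffOn (𝓡 m) (𝓡 m).tangent ∞
      (fun q => (⟨q, Y q⟩ : TangentBundle (𝓡 m) M)) U) {p : M} (hp : p ∈ U) :
    MDifferentiableAt (𝓡 m) 𝓘(ℝ, Ambient n k) (fun q => f.push q (Y q)) p := by
  have h1 : ContMDiff (𝓡 m).tangent 𝓘(ℝ, Ambient n k).tangent ∞
      (tangentMap (𝓡 m) 𝓘(ℝ, Ambient n k) f.toFun) :=
    f.contMDiff.contMDiff_tangentMap le_rfl
  have h2 := (contMDiff_snd_tangentBundle_modelSpace (n := ∞) (Ambient n k)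
    𝓘(ℝ, Ambient n k)).comp h1
  have h3 := (h2.comp_contMDiffOn hY).contMDiffAt (hU.mem_nhds hp)
  exact h3.mdifferentiableAt (by simp)

/-- A parallel subbundle of `V_i ∩ N₁^⊥` is parallel already with respect to the flat connection
of the ambient space. -/
theorem flatDeriv_mem_of_parallel [IsManifold (𝓡 m) ∞ M] {i : Fin l}
    {L : ∀ p, Submodule ℝ (f.normalSpace p)}
    (hL : ∀ p, L p ≤ f.kerIdSubT i p ⊓ f.firstNormalSpaceOrth p) (hpar : f.IsParallelNormal L)
    {U : Set M} {ξ : ∀ q, f.normalSpace q} (hU : IsOpen U) (hξs : f.SmoothNormalFieldOn ξ U)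
    (hξ : ∀ q ∈ U, ξ q ∈ L q) {p : M} (hp : p ∈ U) (X : TangentSpace (𝓡 m) p) :
    flatDeriv (fun q => (ξ q : Ambient n k)) p X ∈ (L p).map (f.normalSpace p).subtype := by
  set Z := flatDeriv (fun q => (ξ q : Ambient n k)) p X with hZ
  have hev : ∀ᶠ q in nhds p, q ∈ U := hU.mem_nhds hp
  have hd : MDifferentiableAt (𝓡 m) 𝓘(ℝ, Ambient n k) (fun q => (ξ q : Ambient n k)) p :=
    (hξs.contMDiffAt hev).mdifferentiableAt (by simp)
  have hcomp : ∀ q ∈ U, ∀ j ≠ i, (ξ q : Ambient n k) j = 0 := fun q hq =>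
    f.mem_kerIdSubT_iff.mp (hL q (hξ q hq)).1
  have hZj : ∀ j ≠ i, Z j = 0 := by
    intro j hj
    have hker : Z ∈ LinearMap.ker (LinearMap.proj j : Ambient n k →ₗ[ℝ] Factor (n j) (k j)) :=
      mfderiv_mem_of_eventually_mem _ (hev.mono fun q hq => hcomp q hq j hj) X
    exact hker
  -- For `k_i ≠ 0`, differentiate `⟨f, ξ⟩ = 0`; the term `⟨f_* X, ξ⟩` vanishes because `ξ` is
  -- normal.
  have hZT : Z ∈ f.targetTangent p := by
    intro j _
    by_cases hj : j = i
    · subst hj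
      intro hk
      have h1 := mfderiv_bilinForm (ambientForm n k) (f.mdifferentiable p) hd X
      have h2 : (mfderiv (𝓡 m) 𝓘(ℝ, ℝ)
          (fun q => ambientForm n k (f.toFun q) (ξ q)) p X : ℝ) = 0 := by
        refine mfderiv_eq_zero_of_eventually_eq (c := 0) (hev.mono fun q hq => ?_) X
        rw [eq_factorIncl_of_forall_ne (hcomp q hq), ambientForm_factorIncl]
        exact (ξ q).2.1 j trivial hk
      have h3 : ambientForm n k (f.toFun p) Z + ambientForm n k (f.push p X) (ξ p) = 0 :=
        h1.symm.trans h2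
      rw [(ξ p).2.2 X, add_zero, eq_factorIncl_of_forall_ne hZj, ambientForm_factorIncl] at h3
      exact h3
    · rw [hZj j hj]
      exact Submodule.zero_mem _
  have hZn : Z ∈ f.normalSpace p := by
    refine ⟨hZT, fun Y₀ => ?_⟩
    -- With `Y₀` extended to a local field, differentiating `⟨f_* Y, ξ⟩ = 0` gives `⟨f_* Y, Z⟩ =
    -- -⟨α(X, Y), ξ⟩`, which is zero as `ξ` is orthogonal to `N₁`.
    obtain ⟨s, hs, hY⟩ := FiberBundle.exists_contMDiffOn_extend (k := ∞) (𝓡 m)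
      (EuclideanSpace ℝ (Fin m)) (V := fun x : M => TangentSpace (𝓡 m) x) Y₀
    obtain ⟨V, hVs, hV, hpV⟩ := mem_nhds_iff.mp hs
    set Y : ∀ q : M, TangentSpace (𝓡 m) q :=
      FiberBundle.extend (EuclideanSpace ℝ (Fin m)) (E := fun x : M => TangentSpace (𝓡 m) x) Y₀
    have hYp : Y p = Y₀ := FiberBundle.extend_apply_self _ _
    have hYd := f.mdifferentiableAt_push hV (hY.mono hVs) hpV
    have h1 := mfderiv_bilinForm (ambientForm n k) hYd hd X
    have h2 : (mfderiv (𝓡 m) 𝓘(ℝ, ℝ)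
        (fun q => ambientForm n k (f.push q (Y q)) (ξ q)) p X : ℝ) = 0 :=
      mfderiv_eq_zero_of_eventually_eq (c := 0)
        (Filter.Eventually.of_forall fun q => (ξ q).2.2 (Y q)) X
    have h3 : ambientForm n k (f.push p (Y p)) Z +
        ambientForm n k (flatDeriv (fun q => f.push q (Y q)) p X) (ξ p) = 0 := h1.symm.trans h2
    have h4 : ambientForm n k (flatDeriv (fun q => f.push q (Y q)) p X) (ξ p) = 0 := by
      rw [← f.normalMetric_toNormal_toTarget]
      exact LinearMap.BilinForm.mem_orthogonal_iff.mp (hL p (hξ p hp)).2 _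
        (Submodule.subset_span ⟨X, Y, V, hV, hpV, hY.mono hVs, rfl⟩)
    rwa [h4, add_zero, hYp] at h3
  have hmem := hpar U ξ hU hξs hξ p hp X
  have h1 := f.toNormal_toTarget_of_mem hZn
  rw [normalConnection, covDeriv, ← hZ, h1] at hmem
  exact ⟨_, hmem, rfl⟩

/-- A subbundle of the normal bundle which is parallel in the ambient space is locally constant. -/
theorem eventually_map_subtype_eq [IsManifold (𝓡 m) ∞ M] {r : ℕ}
    {L : ∀ p, Submodule ℝ (f.normalSpace p)} (hsub : f.IsNormalSubbundle r L)
    (hflat : ∀ (U : Set M) (ξ : ∀ q, f.normalSpace q), IsOpen U → f.SmoothNormalFieldOn ξ U →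
      (∀ q ∈ U, ξ q ∈ L q) → ∀ p ∈ U, ∀ X : TangentSpace (𝓡 m) p,
      flatDeriv (fun q => (ξ q : Ambient n k)) p X ∈ (L p).map (f.normalSpace p).subtype) (p : M) :
    ∀ᶠ q in nhds p, (L q).map (f.normalSpace q).subtype = (L p).map (f.normalSpace p).subtype := by
  have : IsManifold 𝓘(ℝ, EuclideanSpace ℝ (Fin m)) 1 M := IsManifold.of_le (n := ∞) (by simp)
  obtain ⟨U, hU, hpU, ξ, hξs, hξ⟩ := hsub p
  have hrank : ∀ q ∈ U, Module.finrank ℝ ((L q).map (f.normalSpace q).subtype) = r := by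
    intro q hq
    rw [Submodule.finrank_map_subtype_eq, ← (hξ q hq).2, finrank_span_eq_card (hξ q hq).1,
      Fintype.card_fin]
  have hli : LinearIndependent ℝ fun a => (ξ a p : Ambient n k) :=
    (hξ p hpU).1.map' (f.normalSpace p).subtype (Submodule.ker_subtype _)
  -- `Φ` reads off coordinates in the frame at `p`. `G q` expresses these coordinates for the frame
  -- at `q`; it is the identity at `p`, hence invertible nearby.
  obtain ⟨Φ, hΦ⟩ := LinearMap.exists_leftInverse_of_injective
    (Fintype.linearCombination ℝ fun a => (ξ a p : Ambient n k))
    (LinearMap.ker_eq_bot.mpr hli.fintypeLinearCombination_injective)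
  set R := (Fin r → ℝ) →L[ℝ] (Fin r → ℝ) with hR
  set Φ' := LinearMap.toContinuousLinearMap Φ with hΦ'
  set G : M → R := fun q => ∑ b, (ContinuousLinearMap.proj (R := ℝ) b).smulRight
    (Φ' (ξ b q : Ambient n k)) with hG
  have hGapp : ∀ q c, G q c = Φ (∑ b, c b • (ξ b q : Ambient n k)) := by
    intro q c
    rw [hG, sum_apply, map_sum]
    exact Finset.sum_congr rfl fun b _ => by rw [map_smul]; rfl
  have hGp : G p = 1 := ContinuousLinearMap.ext fun c => (hGapp p c).trans
    (LinearMap.congr_fun hΦ c)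
  have hGs : ContMDiffOn (𝓡 m) 𝓘(ℝ, R) ∞ G U := by
    refine contMDiffOn_finsetSum fun b _ => ?_
    exact (((ContinuousLinearMap.smulRightL ℝ (Fin r → ℝ) (Fin r → ℝ)
      (ContinuousLinearMap.proj (R := ℝ) b)).comp Φ').contMDiff).comp_contMDiffOn (hξs b)
  set V : Set M := U ∩ G ⁻¹' {g | IsUnit g} with hV
  have hVo : IsOpen V := hGs.continuousOn.isOpen_inter_preimage hU Units.isOpen
  have hpV : p ∈ V := ⟨hpU, by rw [Set.mem_preimage, hGp]; exact isUnit_one⟩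
  have hGi : ContMDiffOn (𝓡 m) 𝓘(ℝ, R) ∞ (fun q => Ring.inverse (G q)) V := by
    intro q hq
    obtain ⟨g, hg⟩ := hq.2
    have h1 : ContDiffAt ℝ ∞ Ring.inverse (G q) := hg ▸ contDiffAt_ringInverse ℝ g
    exact h1.contMDiffAt.comp_contMDiffWithinAt q ((hGs q hq.1).mono Set.inter_subset_left)
  -- The frame is renormalised so that `Φ (η a)` is the constant basis vector `e_a`.
  set η : Fin r → ∀ q, f.normalSpace q := fun a q =>
    ∑ b, (Ring.inverse (G q) (Pi.single a 1)) b • ξ b q with hη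
  have hηcoe : ∀ a q, (η a q : Ambient n k) =
      ∑ b, (Ring.inverse (G q) (Pi.single a 1)) b • (ξ b q : Ambient n k) := by
    intro a q
    simp [hη]
  have hηL : ∀ a, ∀ q ∈ V, η a q ∈ L q := by
    intro a q hq
    rw [← (hξ q hq.1).2]
    exact Submodule.sum_mem _ fun b _ => Submodule.smul_mem _ _ (Submodule.subset_span ⟨b, rfl⟩)
  have hηs : ∀ a, f.SmoothNormalFieldOn (η a) V := by
    intro a
    unfold SmoothNormalFieldOn
    simp only [hηcoe]
    refine contMDiffOn_finsetSum fun b _ => ?_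
    have hcoeff : ContMDiffOn (𝓡 m) 𝓘(ℝ, ℝ) ∞
        (fun q => (Ring.inverse (G q) : R) (Pi.single a 1) b) V := (((ContinuousLinearMap.proj (R := ℝ) b).comp
      (ContinuousLinearMap.apply ℝ (Fin r → ℝ) (Pi.single a 1))).contMDiff).comp_contMDiffOn hGi
    exact hcoeff.smul ((hξs b).mono Set.inter_subset_left)
  have hΦη : ∀ a, ∀ q ∈ V, Φ (η a q) = Pi.single a 1 := by
    intro a q hq
    rw [hηcoe, ← hGapp, ← mul_apply_eq_comp, Ring.mul_inverse_cancel _ hq.2]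
    rfl
  have hΦinj : ∀ q ∈ V, ∀ z ∈ (L q).map (f.normalSpace q).subtype, Φ z = 0 → z = 0 := by
    rintro q hq _ ⟨z, hz, rfl⟩ h0
    rw [SetLike.mem_coe, ← (hξ q hq.1).2, Submodule.mem_span_range_iff_exists_fun] at hz
    obtain ⟨c, rfl⟩ := hz
    have h1 : G q c = 0 := by
      rw [hGapp, ← h0]
      simp
    have h2 : c = 0 := by
      have h := congrArg (fun w => (Ring.inverse (G q) : R) w) h1
      rw [← mul_apply_eq_comp, Ring.inverse_mul_cancel _ hq.2, map_zero] at h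
      exact h
    simp [h2]
  have hηd : ∀ a, ∀ q ∈ V,
      MDifferentiableAt (𝓡 m) 𝓘(ℝ, Ambient n k) (fun q => (η a q : Ambient n k)) q := fun a q hq =>
    ((hηs a).contMDiffAt (hVo.mem_nhds hq)).mdifferentiableAt (by simp)
  have hη0 : ∀ a, ∀ q ∈ V, ∀ X : TangentSpace (𝓡 m) q,
      (mfderiv (𝓡 m) 𝓘(ℝ, Ambient n k) (fun q => (η a q : Ambient n k)) q X : Ambient n k) = 0 := by
    intro a q hq X
    -- The derivative of `η a` lies in `L`, where `Φ` is injective, and `Φ` kills it because `Φ (η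
    -- a)` is constant. Thus the frame itself is locally constant, without solving any differential
    -- equation.
    refine hΦinj q hq _ (hflat V (η a) hVo (hηs a) (hηL a) q hq X) ?_
    exact (mfderiv_linearMap_comp Φ (hηd a q hq) X).symm.trans
      (mfderiv_eq_zero_of_eventually_eq (c := Pi.single a 1)
        (Filter.eventually_of_mem (hVo.mem_nhds hq) (hΦη a)) X)
  have hconst : ∀ᶠ q in nhds p, ∀ a, (η a q : Ambient n k) = η a p :=
    Filter.eventually_all.mpr fun a =>
      eventually_eq_of_mfderiv_eq_zero hVo (hηd a) (hη0 a) hpV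
  have hηli : LinearIndependent ℝ fun a => (η a p : Ambient n k) := by
    refine LinearIndependent.of_comp Φ ?_
    have : (Φ ∘ fun a => (η a p : Ambient n k)) = Pi.basisFun ℝ (Fin r) := by
      funext a
      rw [Function.comp_apply, hΦη a p hpV, Pi.basisFun_apply]
    rw [this]
    exact (Pi.basisFun ℝ (Fin r)).linearIndependent
  have hspan : ∀ q ∈ V, (∀ a, (η a q : Ambient n k) = η a p) →
      Submodule.span ℝ (Set.range fun a => (η a p : Ambient n k)) =
        (L q).map (f.normalSpace q).subtype := by
    intro q hq h
    refine Submodule.eq_of_le_of_finrank_eq ?_ ?_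
    · rw [Submodule.span_le]
      rintro _ ⟨a, rfl⟩
      exact ⟨η a q, hηL a q hq, h a⟩
    · rw [hrank q hq.1, finrank_span_eq_card hηli, Fintype.card_fin]
  filter_upwards [hconst, hVo.mem_nhds hpV] with q hq hqV
  rw [← hspan q hqV hq, hspan p hpV fun _ => rfl]

/-- All fibres of `L` are one subspace `Λ` of vectors that are normal at every point. Projecting `Λ`
to the `i`-th factor is injective because the other components vanish, and orthogonality to `f_* X`
says that the pairing with `f` has zero derivative. -/
theorem hasConstantNormals_of_parallel [IsManifold (𝓡 m) ∞ M] [ConnectedSpace M] {i : Fin l}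
    {r : ℕ} {L : ∀ p, Submodule ℝ (f.normalSpace p)} (hsub : f.IsNormalSubbundle r L)
    (hL : ∀ p, L p ≤ f.kerIdSubT i p ⊓ f.firstNormalSpaceOrth p) (hpar : f.IsParallelNormal L) :
    f.HasConstantNormals i r := by
  have : IsManifold 𝓘(ℝ, EuclideanSpace ℝ (Fin m)) 1 M := IsManifold.of_le (n := ∞) (by simp)
  obtain ⟨p₀⟩ := (inferInstance : Nonempty M)
  set Λ := (L p₀).map (f.normalSpace p₀).subtype with hΛ
  have hconst : ∀ p, (L p).map (f.normalSpace p).subtype = Λ := fun p =>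
    ((IsLocallyConstant.iff_eventually_eq
      fun p => (L p).map (f.normalSpace p).subtype).mpr fun p =>
        f.eventually_map_subtype_eq hsub (fun U ξ hU hξs hξ p hp X =>
          f.flatDeriv_mem_of_parallel hL hpar hU hξs hξ hp X) p).apply_eq_of_preconnectedSpace p p₀
  have hmem : ∀ z ∈ Λ, ∀ p, z ∈ f.normalSpace p := by
    intro z hz p
    rw [← hconst p] at hz
    obtain ⟨η, -, rfl⟩ := hz
    exact η.2
  have hcomp : ∀ z ∈ Λ, z = factorIncl n k i (z i) := by
    rintro _ ⟨η, hη, rfl⟩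
    exact eq_factorIncl_of_forall_ne (f.mem_kerIdSubT_iff.mp (hL p₀ hη).1)
  set P : Λ →ₗ[ℝ] Factor (n i) (k i) :=
    (LinearMap.proj i : Ambient n k →ₗ[ℝ] Factor (n i) (k i)) ∘ₗ Λ.subtype with hP
  have hPinj : Function.Injective P := by
    intro z w h
    apply Subtype.ext
    rw [hcomp z z.2, hcomp w w.2]
    exact congrArg _ h
  refine ⟨LinearMap.range P, ?_, ?_⟩
  · obtain ⟨U, -, hpU, ξ, -, hξ⟩ := hsub p₀
    rw [LinearMap.finrank_range_of_inj hPinj, hΛ, Submodule.finrank_map_subtype_eq,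
      ← (hξ p₀ hpU).2, finrank_span_eq_card (hξ p₀ hpU).1, Fintype.card_fin]
  · rintro _ ⟨z, rfl⟩
    refine ⟨fun p => (hmem z z.2 p).1 i trivial, fun p q => ?_⟩
    have hform : ∀ x : Ambient n k, ambientForm n k x z = factorForm (n i) (k i) (x i) (P z) := by
      intro x
      rw [hcomp z z.2, ambientForm_factorIncl]
      simp [hP]
    rw [← hform, ← hform]
    have hd : MDifferentiable (𝓡 m) 𝓘(ℝ, ℝ) fun q => ambientForm n k (f.toFun q) z := fun q =>
      ((LinearMap.toContinuousLinearMap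
        ((ambientForm n k).flip z)).contMDiff.mdifferentiable (n := 1) (by simp) _).comp q
        (f.mdifferentiable q)
    refine eq_of_mfderiv_eq_zero hd (fun q X => ?_) p q
    exact (mfderiv_linearMap_comp ((ambientForm n k).flip z) (f.mdifferentiable q) X).trans
      ((hmem z z.2 q).2 X)

end IsometricImmersion

end SpaceFormProduct

end


theorem theorem4p2 {l : ℕ} (n : Fin l → ℕ) (k : Fin l → ℝ) (m : ℕ) {M : Type*}
    [TopologicalSpace M] [T2Space M] [SecondCountableTopology M] [ConnectedSpace M]
    [ChartedSpace (EuclideanSpace ℝ (Fin m)) M] [IsManifold (𝓡 m) ∞ M]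
    [Bundle.RiemannianBundle (fun x : M => TangentSpace (𝓡 m) x)]
    [IsContMDiffRiemannianBundle (𝓡 m) ∞ (EuclideanSpace ℝ (Fin m))
      (fun x : M => TangentSpace (𝓡 m) x)]
    (f : SpaceFormProduct.IsometricImmersion n k m M) (i : Fin l) (r : ℕ) :
    f.CodimReducedBy i r ↔
      ∃ L : ∀ p, Submodule ℝ (f.normalSpace p),
        f.IsNormalSubbundle r L ∧
        (∀ p, L p ≤ f.kerIdSubT i p ⊓ f.firstNormalSpaceOrth p) ∧
        f.IsParallelNormal L :=
  ⟨fun h => h.hasConstantNormals.exists_parallel,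
    fun ⟨_, hsub, hL, hpar⟩ => (f.hasConstantNormals_of_parallel hsub hL hpar).codimReducedBy⟩
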